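/- Let $q$ be a complex number with $|q|<1$. Write $(a;q)_n=\prod_{i=0}^{n-1}(1-aq^i)$, $(a;q)_\infty=\prod_{i\ge 0}(1-aq^i)$, $(a)_n=(a;q)_n$ (so $(q)_n=(q;q)_n$ and $(-q)_n=(-q;q)_n$), and ${n \brack m}_q=\frac{(q)_n}{(q)_m(q)_{n-m}}$ for $0\le m\le n$, ${n \brack m}_q=0$ for $m>n$. The Santos–Sills $q$-Pell sequences are $$\omega_n(q)=\sum_{j=0}^{n}\sum_{k=0}^{j}{j \brack k}_q{n-k \brack j}_q q^{j(j+1)/2+k(k+1)/2},\qquad \Theta_n(q)=\sum_{j=0}^{n}\sum_{k=0}^{j}{j \brack k}_q{n-k \brack j}_q q^{j(j+1)/2+k(k-1)/2}.$$ **Theorem 1.** All the series below converge, those on the right-hand sides absolutely, and $$\sum_{n\ge0}\left(\frac{(-q^2;q^2)_{\infty}}{(q;q^2)_{\infty}}-\omega_n(q)\right)=\frac{(-q^2;q^2)_{\infty}}{(q;q^2)_{\infty}}\left(-\frac{1}{2}+2\sum_{n\ge1}\frac{q^{2n-1}}{1-q^{2n-1}}\right)+\frac{1}{2}\sum_{n\ge0}\frac{(q)_n(-1)^nq^{n(n+1)/2}}{(-q)_{n}},$$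 $$\sum_{n\ge0}\left(\frac{(-q;q^2)_{\infty}}{(q;q^2)_{\infty}}-\Theta_n(q)\right)=2\,\frac{(-q;q^2)_{\infty}}{(q;q^2)_{\infty}}\sum_{n\ge1}\frac{q^{2n-1}}{1-q^{2n-1}}+\sum_{n\ge1}\frac{(q)_{n-1}(-1)^{n-1}q^{n(n+1)/2}}{(-q)_{n}}.$$ -/

import Mathlib

noncomputable section

/-- The finite `q`-shifted factorial `(a; q)_n = ∏_{i < n} (1 - a q^i)`. -/
def qPoch (a q : ℂ) (n : ℕ) : ℂ := ∏ i ∈ Finset.range n, (1 - a * q ^ i)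

/-- The infinite `q`-shifted factorial `(a; q)_∞ = ∏_{i ≥ 0} (1 - a q^i)`, for `|q| < 1`. -/
def qPochInf (a q : ℂ) : ℂ := ∏' i : ℕ, (1 - a * q ^ i)

/-- The Gaussian binomial coefficient `(q)_n / ((q)_m (q)_{n-m})`, with the usual value `0`
for `m > n`. The denominators do not vanish for `|q| < 1`. -/
def qBinom (q : ℂ) (n m : ℕ) : ℂ :=
  if m ≤ n then qPoch q q n / (qPoch q q m * qPoch q q (n - m)) else 0

/-- The Santos–Sills `q`-Pell sequence
`ω_n(q) = ∑_{0 ≤ k ≤ j ≤ n} [j, k]_q [n - k, j]_q q^{j(j+1)/2 + k(k+1)/2}`. -/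
def pellOmega (q : ℂ) (n : ℕ) : ℂ :=
  ∑ j ∈ Finset.range (n + 1), ∑ k ∈ Finset.range (j + 1),
    qBinom q j k * qBinom q (n - k) j * q ^ (j * (j + 1) / 2 + k * (k + 1) / 2)

/-- The Santos–Sills `q`-Pell sequence
`Θ_n(q) = ∑_{0 ≤ k ≤ j ≤ n} [j, k]_q [n - k, j]_q q^{j(j+1)/2 + k(k-1)/2}`. -/
def pellTheta (q : ℂ) (n : ℕ) : ℂ :=
  ∑ j ∈ Finset.range (n + 1), ∑ k ∈ Finset.range (j + 1),
    qBinom q j k * qBinom q (n - k) j * q ^ (j * (j + 1) / 2 + k * (k - 1) / 2)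

/-- The infinite product defining `(a; q)_∞` converges for `|q| < 1`. -/
theorem hasProd_qPochInf (a q : ℂ) (hq : ‖q‖ < 1) :
    HasProd (fun i : ℕ => 1 - a * q ^ i) (qPochInf a q) := by
  have hs : Summable fun i : ℕ => ‖-(a * q ^ i)‖ := by
    simpa [norm_mul, norm_pow] using
      (summable_geometric_of_lt_one (norm_nonneg q) hq).mul_left ‖a‖
  have h := (multipliable_one_add_of_summable hs).hasProd
  simpa [qPochInf, sub_eq_add_neg] using h

/-- A factorial `(a; q)_n` with `|a| < 1` and `|q| < 1` does not vanish. -/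
theorem qPoch_ne_zero (a q : ℂ) (ha : ‖a‖ < 1) (hq : ‖q‖ < 1) (n : ℕ) : qPoch a q n ≠ 0 := by
  refine Finset.prod_ne_zero_iff.mpr fun i _ h => ?_
  have h1 : ‖a * q ^ i‖ < 1 := by
    rw [norm_mul, norm_pow]
    exact mul_lt_one_of_nonneg_of_lt_one_left (norm_nonneg a) ha
      (pow_le_one₀ (norm_nonneg q) hq.le)
  rw [← sub_eq_zero.mp h] at h1
  simp at h1

/-- The product `(a; q)_∞` with `|a| < 1` and `|q| < 1` does not vanish. -/
theorem qPochInf_ne_zero (a q : ℂ) (ha : ‖a‖ < 1) (hq : ‖q‖ < 1) : qPochInf a q ≠ 0 := by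
  have hs : Summable fun i : ℕ => ‖-(a * q ^ i)‖ := by
    simpa [norm_mul, norm_pow] using
      (summable_geometric_of_lt_one (norm_nonneg q) hq).mul_left ‖a‖
  have h := tprod_one_add_ne_zero_of_summable (f := fun i : ℕ => -(a * q ^ i)) (fun i h => by
    have := qPoch_ne_zero a q ha hq (i + 1)
    rw [qPoch, Finset.prod_range_succ] at this
    exact (mul_ne_zero_iff.mp this).2 (by rw [sub_eq_add_neg]; exact h)) hs
  simpa [qPochInf, sub_eq_add_neg] using h

end

open Filter Topology Finset

/-! Both sequences are instances of `pell q z`: z = q for ω and z = 1 for Θ. As n grows, [n, j]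
tends to 1/(q)_j, so the sum of tails is an absolutely convergent triple series. Summing over n
first turns it into ∑_j q^{j(j+1)/2} (-z)_j/(q)_j · S_j, where S_j = ∑_{i<j} (z q^i/(1+z q^i) +
1/(1-q^{i+1})) (`hasSum_pell_tails`). The limit itself is the same series without S_j, a product by
Lebesgue's identity (`tsum_lebesgue`).

The weights S_j come from a vanishing bilateral series. Put z = q^e, y = q/z, E(y) = (-y;q)_∞ and D
= y E'. Sum (2j+N) q^{j(j+N)}, with N = n-l+e, against the Euler coefficients of E(-q) and E(y) over
j ∈ ℤ and n, l ≥ 0: the reflection j ↦ -N-j shows that the total is 0 (`tsum_thetaTerm`). Summing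
over n and l instead leaves, for each j, a combination of E and D at -q^{j+1} and y q^{-j}. For j ≥
0 it is proportional to the j-th term above with S_j + c in place of S_j, where c = e + D(-q)/E(-q)
- D(y)/E(y) (`thetaFiber_nonneg`). For j < 0, E(-q^{j+1}) vanishes, only its derivative survives,
and the alternating series of the theorem appears (`thetaFiber_neg`). Moving c times Lebesgue's
product to the other side gives the result; logarithmic derivatives turn c into a Lambert series
(`eulerSumD_div_sub`). -/

/-! ### Recursions and uniform bounds for shifted factorials. -/

theorem qPoch_succ (a q : ℂ) (n : ℕ) : qPoch a q (n + 1) = qPoch a q n * (1 - a * q ^ n) :=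
  Finset.prod_range_succ _ _

theorem qPoch_succ_left (a q : ℂ) (n : ℕ) :
    qPoch a q (n + 1) = (1 - a) * qPoch (a * q) q n := by
  simp only [qPoch, Finset.prod_range_succ']
  rw [mul_comm]
  simp [pow_succ', mul_assoc]

theorem qPoch_zero (a q : ℂ) : qPoch a q 0 = 1 := by simp [qPoch]

theorem qPoch_add (a q : ℂ) (m n : ℕ) :
    qPoch a q (m + n) = qPoch a q m * qPoch (a * q ^ m) q n := by
  simp only [qPoch, Finset.prod_range_add, pow_add, mul_assoc]

theorem tendsto_qPoch (a q : ℂ) (hq : ‖q‖ < 1) :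
    Tendsto (qPoch a q) atTop (𝓝 (qPochInf a q)) :=
  (hasProd_qPochInf a q hq).tendsto_prod_nat

theorem exists_norm_qPoch_inv_le (a q : ℂ) (h : ∀ n, qPoch a q n ≠ 0) (hi : qPochInf a q ≠ 0)
    (hq : ‖q‖ < 1) : ∃ C : ℝ, 0 < C ∧ ∀ n, ‖(qPoch a q n)⁻¹‖ ≤ C := by
  have := ((tendsto_qPoch a q hq).inv₀ hi).norm.bddAbove_range
  obtain ⟨C, hC⟩ := this
  have hC' : ∀ n, ‖(qPoch a q n)⁻¹‖ ≤ C := fun n => hC ⟨n, rfl⟩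
  exact ⟨C, lt_of_lt_of_le (norm_pos_iff.2 (inv_ne_zero (h 0))) (hC' 0), hC'⟩

/-- Factor by factor, |1 - a q^i| ≤ 1 + |q|^i, so the convergent products (-1;|q|)_n dominate
uniformly in a. -/
theorem exists_norm_qPoch_le (q : ℂ) (hq : ‖q‖ < 1) :
    ∃ C : ℝ, 0 < C ∧ ∀ a : ℂ, ‖a‖ ≤ 1 → ∀ n, ‖qPoch a q n‖ ≤ C := by
  have hq' : ‖((‖q‖ : ℝ) : ℂ)‖ < 1 := by simpa using hq
  obtain ⟨C, hC⟩ := (tendsto_qPoch (-1) (‖q‖ : ℝ) hq').norm.bddAbove_range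
  have hC' : ∀ n, ‖qPoch (-1) (‖q‖ : ℝ) n‖ ≤ C := fun n => hC ⟨n, rfl⟩
  refine ⟨C, lt_of_lt_of_le one_pos ?_, fun a ha n => le_trans ?_ (hC' n)⟩
  · simpa [qPoch] using hC' 0
  · simp only [qPoch, norm_prod]
    refine Finset.prod_le_prod (fun i _ => norm_nonneg _) fun i _ => ?_
    have h1 : (1 : ℂ) - -1 * ((‖q‖ : ℝ) : ℂ) ^ i = ((1 + ‖q‖ ^ i : ℝ) : ℂ) := by push_cast; ring_nf
    rw [h1, Complex.norm_of_nonneg (by positivity)]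
    refine (norm_sub_le _ _).trans ?_
    rw [norm_mul, norm_pow, norm_one]
    gcongr
    exact mul_le_of_le_one_left (by positivity) ha

/-! ### Euler's expansion of (-y;q)_∞ and its logarithmic derivative. -/

/-- The coefficient `q ^ (n choose 2) / (q; q)_n` of Euler's expansion of `(-y; q)_∞`. -/
noncomputable def eulerCoeff (q : ℂ) (n : ℕ) : ℂ := q ^ n.choose 2 / qPoch q q n

/-- Euler's series `∑ q ^ (n choose 2) y ^ n / (q; q)_n`. -/
noncomputable def eulerSum (q y : ℂ) : ℂ := ∑' n : ℕ, eulerCoeff q n * y ^ n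

/-- The image of Euler's series under `y d/dy`. -/
noncomputable def eulerSumD (q y : ℂ) : ℂ := ∑' n : ℕ, n * (eulerCoeff q n * y ^ n)

theorem one_sub_pow_ne_zero {q : ℂ} (hq : ‖q‖ < 1) (n : ℕ) : 1 - q ^ (n + 1) ≠ 0 := by
  intro h
  have : ‖q ^ (n + 1)‖ < 1 := by
    rw [norm_pow]; exact pow_lt_one₀ (norm_nonneg _) hq (by omega)
  rw [← sub_eq_zero.1 h] at this
  simp at this

theorem one_add_pow_ne_zero {q : ℂ} (hq : ‖q‖ < 1) (n : ℕ) : 1 + q ^ n ≠ 0 := by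
  rcases n with _ | n
  · norm_num
  intro h
  have : ‖q ^ (n + 1)‖ < 1 := by
    rw [norm_pow]; exact pow_lt_one₀ (norm_nonneg _) hq (by omega)
  rw [← neg_eq_of_add_eq_zero_right h] at this
  simp at this

theorem eulerCoeff_succ {q : ℂ} (hq : ‖q‖ < 1) (n : ℕ) :
    eulerCoeff q (n + 1) * (1 - q ^ (n + 1)) = q ^ n * eulerCoeff q n := by
  have h1 := one_sub_pow_ne_zero hq n
  have h2 := qPoch_ne_zero q q hq hq n
  rw [eulerCoeff, eulerCoeff, qPoch_succ, ← pow_succ', Nat.choose_succ_succ' n 1, Nat.choose_one_right, pow_add]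
  field_simp

theorem eulerCoeff_zero (q : ℂ) : eulerCoeff q 0 = 1 := by simp [eulerCoeff, qPoch]

theorem summable_norm_eulerCoeff_mul_pow {q : ℂ} (hq : ‖q‖ < 1) (y : ℂ) :
    Summable fun n : ℕ => ‖(n + 1 : ℂ) * (eulerCoeff q n * y ^ n)‖ := by
  have key : ∀ w : ℝ, 0 ≤ w → Summable fun n : ℕ => ‖eulerCoeff q n‖ * w ^ n := by
    intro w hw
    have ht : Tendsto (fun n : ℕ => ‖q ^ n / (1 - q ^ (n + 1))‖ * w) atTop (𝓝 0) := by
      have h0 := tendsto_pow_atTop_nhds_zero_of_norm_lt_one hq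
      have h1 : Tendsto (fun n : ℕ => 1 - q ^ (n + 1)) atTop (𝓝 (1 - 0)) :=
        tendsto_const_nhds.sub (h0.comp (tendsto_add_atTop_nat 1))
      have := ((h0.div h1 (by simp)).norm).mul_const w
      simpa using this
    refine summable_of_ratio_norm_eventually_le (r := 1 / 2) (by norm_num) ?_
    filter_upwards [ht.eventually (gt_mem_nhds (show (0 : ℝ) < 1 / 2 by norm_num))] with n hn
    have h2 : eulerCoeff q (n + 1) = q ^ n / (1 - q ^ (n + 1)) * eulerCoeff q n := by
      rw [div_mul_eq_mul_div, ← eulerCoeff_succ hq, mul_div_cancel_right₀ _ (one_sub_pow_ne_zero hq n)]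
    rw [h2]
    simp only [norm_mul, norm_norm, norm_pow, Real.norm_of_nonneg hw, pow_succ]
    have h3 : 0 ≤ ‖eulerCoeff q n‖ * w ^ n := by positivity
    calc _ = (‖q ^ n / (1 - q ^ (n + 1))‖ * w) * (‖eulerCoeff q n‖ * w ^ n) := by ring
      _ ≤ _ := by gcongr
  -- The factor n + 1 is at most 2^n and is absorbed by taking w = 2|y|.
  refine Summable.of_nonneg_of_le (fun _ => norm_nonneg _) (fun n => ?_)
    (key (2 * ‖y‖) (by positivity))
  have h4 : ‖(n + 1 : ℂ)‖ ≤ 2 ^ n := by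
    have : ((n : ℂ) + 1) = ((n + 1 : ℕ) : ℂ) := by push_cast; rfl
    rw [this, Complex.norm_natCast]
    exact_mod_cast Nat.lt_two_pow_self (n := n)
  rw [norm_mul, norm_mul, norm_pow, mul_pow]
  calc _ ≤ 2 ^ n * (‖eulerCoeff q n‖ * ‖y‖ ^ n) := by gcongr
    _ = _ := by ring

theorem summable_norm_eulerSumD {q : ℂ} (hq : ‖q‖ < 1) (y : ℂ) :
    Summable fun n : ℕ => ‖(n : ℂ) * (eulerCoeff q n * y ^ n)‖ := by
  refine Summable.of_nonneg_of_le (fun _ => norm_nonneg _) (fun n => ?_)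
    (summable_norm_eulerCoeff_mul_pow hq y)
  rw [norm_mul, norm_mul (n + 1 : ℂ)]
  gcongr
  have : ((n : ℂ) + 1) = ((n + 1 : ℕ) : ℂ) := by push_cast; rfl
  rw [this, Complex.norm_natCast, Complex.norm_natCast]
  simp

theorem summable_norm_eulerSum {q : ℂ} (hq : ‖q‖ < 1) (y : ℂ) :
    Summable fun n : ℕ => ‖eulerCoeff q n * y ^ n‖ := by
  refine Summable.of_nonneg_of_le (fun _ => norm_nonneg _) (fun n => ?_)
    (summable_norm_eulerCoeff_mul_pow hq y)
  rw [norm_mul (n + 1 : ℂ)]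
  have : ((n : ℂ) + 1) = ((n + 1 : ℕ) : ℂ) := by push_cast; rfl
  rw [this, Complex.norm_natCast]
  refine le_mul_of_one_le_left (norm_nonneg _) (by simp)

theorem hasSum_eulerSum {q : ℂ} (hq : ‖q‖ < 1) (y : ℂ) :
    HasSum (fun n : ℕ => eulerCoeff q n * y ^ n) (eulerSum q y) :=
  (summable_norm_eulerSum hq y).of_norm.hasSum

theorem hasSum_eulerSumD {q : ℂ} (hq : ‖q‖ < 1) (y : ℂ) :
    HasSum (fun n : ℕ => n * (eulerCoeff q n * y ^ n)) (eulerSumD q y) :=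
  (summable_norm_eulerSumD hq y).of_norm.hasSum

theorem eulerSum_eq {q : ℂ} (hq : ‖q‖ < 1) (y : ℂ) :
    eulerSum q y = (1 + y) * eulerSum q (y * q) := by
  have h1 := (hasSum_eulerSum hq y).sub (hasSum_eulerSum hq (y * q))
  have h2 := (hasSum_eulerSum hq (y * q)).mul_left y
  have h3 := (hasSum_nat_add_iff' 1).2 h1
  have : (fun n : ℕ => y * (eulerCoeff q n * (y * q) ^ n)) = fun n : ℕ =>
      eulerCoeff q (n + 1) * y ^ (n + 1) - eulerCoeff q (n + 1) * (y * q) ^ (n + 1) := by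
    funext n
    have := eulerCoeff_succ hq n
    simp only [mul_pow]
    linear_combination (-y ^ (n + 1)) * this
  rw [this] at h2
  have h4 := h2.unique h3
  simp at h4
  linear_combination -h4

/-- This is y d/dy applied to `eulerSum_eq`; it is proved on coefficients to avoid differentiating a
series. -/
theorem eulerSumD_eq {q : ℂ} (hq : ‖q‖ < 1) (y : ℂ) :
    eulerSumD q y = (1 + y) * eulerSumD q (y * q) + y * eulerSum q (y * q) := by
  have h1 := (hasSum_eulerSumD hq y).sub (hasSum_eulerSumD hq (y * q))
  have h2 := ((hasSum_eulerSumD hq (y * q)).add (hasSum_eulerSum hq (y * q))).mul_left y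
  have h3 := (hasSum_nat_add_iff' 1).2 h1
  have : (fun n : ℕ => y * (n * (eulerCoeff q n * (y * q) ^ n) + eulerCoeff q n * (y * q) ^ n)) =
      fun n : ℕ => ((n + 1 : ℕ) : ℂ) * (eulerCoeff q (n + 1) * y ^ (n + 1)) -
        ((n + 1 : ℕ) : ℂ) * (eulerCoeff q (n + 1) * (y * q) ^ (n + 1)) := by
    funext n
    have := eulerCoeff_succ hq n
    simp only [mul_pow]
    push_cast
    linear_combination (-(n + 1) * y ^ (n + 1)) * this
  rw [this] at h2
  have h4 := h2.unique h3
  simp at h4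
  linear_combination -h4

/-- Dominated convergence: iterating a functional equation y ↦ yq leaves only the constant term in
the limit. -/
theorem tendsto_tsum_mul_pow {q : ℂ} (hq : ‖q‖ < 1) (d : ℕ → ℂ) (y : ℂ)
    (hd : Summable fun n => ‖d n * y ^ n‖) :
    Tendsto (fun m : ℕ => ∑' n, d n * (y * q ^ m) ^ n) atTop (𝓝 (d 0)) := by
  have h : ∑' n, (if n = 0 then d 0 else 0) = d 0 := by simp
  rw [← h]
  refine tendsto_tsum_of_dominated_convergence hd (fun n => ?_) (Eventually.of_forall fun m n => ?_)
  · rcases n with _ | n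
    · simp
    · have h0 : Tendsto (fun m : ℕ => (y * q ^ m) ^ (n + 1)) atTop (𝓝 ((y * 0) ^ (n + 1))) :=
        ((tendsto_pow_atTop_nhds_zero_of_norm_lt_one hq).const_mul y).pow _
      simpa using h0.const_mul (d (n + 1))
  · rw [norm_mul, norm_mul, norm_pow, norm_pow, norm_mul, norm_pow]
    gcongr
    exact mul_le_of_le_one_right (norm_nonneg _) (pow_le_one₀ (norm_nonneg _) hq.le)

theorem eulerSum_eq_qPoch_mul {q : ℂ} (hq : ‖q‖ < 1) (y : ℂ) (n : ℕ) :
    eulerSum q y = qPoch (-y) q n * eulerSum q (y * q ^ n) := by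
  induction n with
  | zero => simp [qPoch]
  | succ n ih =>
    rw [ih, eulerSum_eq hq (y * q ^ n), qPoch_succ, pow_succ]
    ring_nf

theorem eulerSum_eq_qPochInf {q : ℂ} (hq : ‖q‖ < 1) (y : ℂ) :
    eulerSum q y = qPochInf (-y) q := by
  have h1 := (tendsto_qPoch (-y) q hq).mul
    (tendsto_tsum_mul_pow hq (eulerCoeff q) y (summable_norm_eulerSum hq y))
  rw [eulerCoeff_zero, mul_one] at h1
  refine tendsto_nhds_unique (tendsto_const_nhds.congr fun n => ?_) h1
  exact eulerSum_eq_qPoch_mul hq y n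

/-- Only the first n factors need to be nonzero. The formula is thus available at y q^{-j}, where
the finite sum is later reflected. -/
theorem eulerSumD_eq_qPoch_mul {q : ℂ} (hq : ‖q‖ < 1) (y : ℂ) (n : ℕ)
    (h : ∀ i < n, 1 + y * q ^ i ≠ 0) :
    eulerSumD q y = qPoch (-y) q n * (eulerSumD q (y * q ^ n) +
      (∑ i ∈ range n, y * q ^ i / (1 + y * q ^ i)) * eulerSum q (y * q ^ n)) := by
  induction n with
  | zero => simp [qPoch]
  | succ n ih =>
    rw [ih fun i hi => h i (by omega), eulerSumD_eq hq (y * q ^ n), eulerSum_eq hq (y * q ^ n),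
      qPoch_succ, sum_range_succ, mul_assoc y, ← pow_succ]
    have := h n (by omega)
    rw [show 1 - -y * q ^ n = 1 + y * q ^ n by ring]
    field_simp
    ring_nf

theorem summable_mul_pow_div {q : ℂ} (hq : ‖q‖ < 1) (y : ℂ) :
    Summable fun i : ℕ => y * q ^ i / (1 + y * q ^ i) := by
  have h0 : Tendsto (fun i : ℕ => y * q ^ i) atTop (𝓝 (y * 0)) :=
    (tendsto_pow_atTop_nhds_zero_of_norm_lt_one hq).const_mul y
  have h1 : Tendsto (fun i : ℕ => (1 + y * q ^ i)⁻¹) atTop (𝓝 (1 + y * 0)⁻¹) :=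
    (tendsto_const_nhds.add h0).inv₀ (by simp)
  obtain ⟨C, hC⟩ := h1.norm.bddAbove_range
  have hC' : ∀ n, ‖(1 + y * q ^ n)⁻¹‖ ≤ C := fun n => hC ⟨n, rfl⟩
  refine Summable.of_norm_bounded (g := fun i => ‖y‖ * ‖q‖ ^ i * C)
    (((summable_geometric_of_lt_one (norm_nonneg q) hq).mul_left _).mul_right _) fun i => ?_
  rw [div_eq_mul_inv, norm_mul, norm_mul, norm_pow]
  gcongr
  exact hC' i

/-- The logarithmic derivative of `(-y; q)_∞`. -/
theorem eulerSumD_eq_mul_tsum {q : ℂ} (hq : ‖q‖ < 1) (y : ℂ) (h : ∀ i, 1 + y * q ^ i ≠ 0) :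
    eulerSumD q y = eulerSum q y * ∑' i : ℕ, y * q ^ i / (1 + y * q ^ i) := by
  have h1 := (tendsto_qPoch (-y) q hq).mul
    ((tendsto_tsum_mul_pow hq (fun n => n * eulerCoeff q n) y (by
      simpa only [mul_assoc] using summable_norm_eulerSumD hq y)).add
    ((summable_mul_pow_div hq y).hasSum.tendsto_sum_nat.mul
      (tendsto_tsum_mul_pow hq (eulerCoeff q) y (summable_norm_eulerSum hq y))))
  rw [eulerCoeff_zero] at h1
  simp only [Nat.cast_zero, zero_add, mul_one] at h1
  rw [← eulerSum_eq_qPochInf hq] at h1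
  refine tendsto_nhds_unique (tendsto_const_nhds.congr fun n => ?_) h1
  rw [eulerSumD_eq_qPoch_mul hq y n fun i _ => h i]
  simp only [eulerSumD, eulerSum, mul_assoc]

/-! ### The antisymmetric triple series. -/

/-- The general term of an absolutely convergent triple series which is antisymmetric under
`j ↦ -(n - l + e) - j`. -/
noncomputable def thetaTerm (q y : ℂ) (e : ℤ) (x : ℤ × ℕ × ℕ) : ℂ :=
  ((2 * x.1 + ((x.2.1 : ℤ) - x.2.2 + e) : ℤ) : ℂ) *
    q ^ (x.1 * (x.1 + ((x.2.1 : ℤ) - x.2.2 + e))) *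
    (eulerCoeff q x.2.1 * (-q) ^ x.2.1 * (eulerCoeff q x.2.2 * y ^ x.2.2))

/-- The quadratic part on the right is (j+n)² + (j-l)². It degenerates along n = -j, l = j, but n, l
≥ 0 rescues coercivity: the first square is at least j² + n² when j ≥ 0, the second at least j² + l²
when j ≤ 0. -/
theorem two_mul_thetaExponent_ge (e : ℤ) (he : e = 0 ∨ e = 1) (j : ℤ) (n l : ℕ) :
    (n : ℤ) + l + j.natAbs ≤
      2 * (j * (j + (n - l + e))) + n * (n - 1) + l * (l - 1) + 2 * n + 3 := by
  have hn : (0 : ℤ) ≤ n := Int.natCast_nonneg n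
  have hl : (0 : ℤ) ≤ l := Int.natCast_nonneg l
  have aux : ∀ i : ℤ, 0 ≤ (i - 1) * (i - 2) := by
    intro i
    rcases le_or_gt i 1 with h | h
    · nlinarith
    · nlinarith
  rcases le_total 0 j with hj | hj
  · rw [Int.natCast_natAbs, abs_of_nonneg hj]
    rcases he with rfl | rfl <;>
      nlinarith [aux j, sq_nonneg ((l : ℤ) - j - 1), mul_nonneg hj hn, sq_nonneg (n : ℤ)]
  · rw [Int.natCast_natAbs, abs_of_nonpos hj]
    rcases he with rfl | rfl <;>
      nlinarith [aux (-j), sq_nonneg ((l : ℤ) - 1), mul_nonneg (neg_nonneg.2 hj) hl,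
        sq_nonneg ((n : ℤ) + j)]

theorem summable_succ_mul_pow {s : ℝ} (h0 : 0 ≤ s) (h1 : s < 1) :
    Summable fun n : ℕ => ((n : ℝ) + 1) * s ^ n := by
  have h := summable_pow_mul_geometric_of_norm_lt_one 1 (r := s) (by
    rwa [Real.norm_of_nonneg h0])
  simpa [add_mul] using h.add (summable_geometric_of_lt_one h0 h1)

theorem summable_int_succ_mul_pow {s : ℝ} (h0 : 0 ≤ s) (h1 : s < 1) :
    Summable fun j : ℤ => ((j.natAbs : ℝ) + 1) * s ^ j.natAbs := by
  refine Summable.of_nat_of_neg ?_ ?_ <;> simpa using summable_succ_mul_pow h0 h1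

theorem summable_thetaTerm {q : ℂ} (hq0 : q ≠ 0) (hq : ‖q‖ < 1) {y : ℂ} (hy : ‖y‖ ≤ 1)
    {e : ℤ} (he : e = 0 ∨ e = 1) : Summable (thetaTerm q y e) := by
  obtain ⟨C, hC0, hC⟩ := exists_norm_qPoch_inv_le q q (qPoch_ne_zero q q hq hq)
    (qPochInf_ne_zero q q hq hq) hq
  have hr : 0 < ‖q‖ := norm_pos_iff.2 hq0
  -- The exponent estimate bounds twice the exponent, hence the square root; its additive 3 becomes
  -- the factor s⁻³.
  set s : ℝ := √‖q‖ with hs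
  have hs0 : 0 < s := Real.sqrt_pos.2 hr
  have hs1 : s < 1 := by rw [hs, Real.sqrt_lt' one_pos]; simpa using hq
  have hss : s ^ (2 : ℤ) = ‖q‖ := by rw [zpow_ofNat]; exact Real.sq_sqrt hr.le
  have hsum := (summable_int_succ_mul_pow hs0.le hs1).mul_of_nonneg
    ((summable_succ_mul_pow hs0.le hs1).mul_of_nonneg (summable_succ_mul_pow hs0.le hs1)
      (fun _ => by positivity) (fun _ => by positivity))
    (fun _ => by positivity) (fun _ => by positivity)
  refine Summable.of_norm_bounded (hsum.mul_left (2 * C ^ 2 * (s ^ 3)⁻¹)) ?_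
  rintro ⟨j, n, l⟩
  simp only [thetaTerm]
  have hw : ‖((2 * j + ((n : ℤ) - l + e) : ℤ) : ℂ)‖ ≤
      2 * ((j.natAbs + 1) * ((n + 1) * (l + 1))) := by
    rw [Complex.norm_intCast]
    have h1 : |2 * j + ((n : ℤ) - l + e)| ≤ 2 * j.natAbs + n + l + 1 := by
      rw [abs_le]; rcases he with rfl | rfl <;> omega
    have h2 : (2 * j.natAbs + n + l + 1 : ℤ) ≤ 2 * ((j.natAbs + 1) * ((n + 1) * (l + 1))) := by
      generalize j.natAbs = a
      have : 2 * a + n + l + 1 ≤ 2 * ((a + 1) * ((n + 1) * (l + 1))) := by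
        nlinarith [Nat.zero_le (a * n), Nat.zero_le (a * l), Nat.zero_le (n * l),
          Nat.zero_le (a * (n * l))]
      exact_mod_cast this
    have h3 : ((|2 * j + ((n : ℤ) - l + e)| : ℤ) : ℝ) ≤
        ((2 * ((j.natAbs + 1) * ((n + 1) * (l + 1))) : ℤ) : ℝ) := by
      exact_mod_cast h1.trans h2
    rw [Int.cast_abs] at h3
    exact h3.trans (le_of_eq (by
      simp only [Int.cast_mul, Int.cast_add, Int.cast_natCast, Int.cast_ofNat, Int.cast_one]))
  have hc : ∀ m, ‖eulerCoeff q m‖ ≤ ‖q‖ ^ m.choose 2 * C := fun m => by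
    rw [eulerCoeff, div_eq_mul_inv, norm_mul, norm_pow]
    gcongr
    exact hC m
  have hch : ∀ m : ℕ, (2 * m.choose 2 : ℤ) = m * (m - 1) := fun m => by
    have := Nat.choose_two_right m
    have h2 := Nat.div_mul_cancel (Nat.even_mul_pred_self m).two_dvd
    rw [← this] at h2
    rcases m with _ | m
    · simp
    · push_cast
      have h3 : (m + 1).choose 2 * 2 = (m + 1) * m := by simpa using h2
      have : (((m + 1).choose 2 : ℕ) : ℤ) * 2 = (m + 1) * m := by exact_mod_cast h3
      linarith
  have hexp : ‖q‖ ^ (j * (j + ((n : ℤ) - l + e))) *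
      (‖q‖ ^ n.choose 2 * ‖q‖ ^ n * ‖q‖ ^ l.choose 2) ≤ s ^ n * s ^ l * s ^ j.natAbs * (s ^ 3)⁻¹ := by
    simp only [← zpow_natCast, ← hss, ← zpow_mul, ← zpow_neg, ← zpow_add₀ hs0.ne']
    refine zpow_le_zpow_right_of_le_one₀ hs0 hs1.le ?_
    have := two_mul_thetaExponent_ge e he j n l
    have h1 := hch n
    have h2 := hch l
    push_cast at this ⊢
    linarith
  rw [norm_mul, norm_mul, norm_mul, norm_mul, norm_mul, norm_zpow, norm_pow, norm_pow, norm_neg]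
  calc _ ≤ 2 * ((j.natAbs + 1) * ((n + 1) * (l + 1))) * ‖q‖ ^ (j * (j + ((n : ℤ) - l + e))) *
      (‖q‖ ^ n.choose 2 * C * ‖q‖ ^ n * (‖q‖ ^ l.choose 2 * C * 1)) := by
        gcongr
        · exact hc n
        · exact hc l
        · exact pow_le_one₀ (norm_nonneg _) hy
    _ = 2 * ((j.natAbs + 1) * ((n + 1) * (l + 1))) * C ^ 2 * (‖q‖ ^ (j * (j + ((n : ℤ) - l + e))) *
      (‖q‖ ^ n.choose 2 * ‖q‖ ^ n * ‖q‖ ^ l.choose 2)) := by ring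
    _ ≤ 2 * ((j.natAbs + 1) * ((n + 1) * (l + 1))) * C ^ 2 *
        (s ^ n * s ^ l * s ^ j.natAbs * (s ^ 3)⁻¹) := by gcongr
    _ = _ := by ring

/-- With N = n - l + e, the reflection j ↦ -N-j preserves j(j+N) and negates 2j+N. Convergence plays
no role: reindexing and sign extraction hold for any `tsum`. -/
theorem tsum_thetaTerm (q y : ℂ) (e : ℤ) : ∑' x : ℤ × ℕ × ℕ, thetaTerm q y e x = 0 := by
  let φ : ℤ × ℕ × ℕ → ℤ × ℕ × ℕ := fun x => (-((x.2.1 : ℤ) - x.2.2 + e) - x.1, x.2)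
  have hφ : Function.Involutive φ := fun x => by
    rcases x with ⟨j, n, l⟩
    simp [φ]
  have h := Equiv.tsum_eq (Function.Involutive.toPerm φ hφ) (thetaTerm q y e)
  have h2 : ∀ x : ℤ × ℕ × ℕ, thetaTerm q y e ((Function.Involutive.toPerm φ hφ) x) = -thetaTerm q y e x := by
    rintro ⟨j, n, l⟩
    simp only [thetaTerm, Function.Involutive.coe_toPerm, φ]
    rw [show (2 * (-((n : ℤ) - l + e) - j) + ((n : ℤ) - l + e)) = -(2 * j + ((n : ℤ) - l + e)) by ring,
      show (-((n : ℤ) - l + e) - j) * (-((n : ℤ) - l + e) - j + ((n : ℤ) - l + e)) =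
        j * (j + ((n : ℤ) - l + e)) by ring]
    push_cast
    ring
  simp only [h2, tsum_neg] at h
  exact self_eq_neg.1 h.symm

/-- For fixed j, the power q^{j(n-l)} splits as (q^j)^n (q^{-j})^l, so the double series factors
into Euler series; the weights n and -l produce the two derivatives. -/
theorem hasSum_thetaTerm_fiber {q : ℂ} (hq0 : q ≠ 0) (hq : ‖q‖ < 1) (y : ℂ) (e j : ℤ) :
    HasSum (fun p : ℕ × ℕ => thetaTerm q y e (j, p))
      (q ^ (j * (j + e)) * (eulerSumD q (-q * q ^ j) * eulerSum q (y * q ^ (-j)) -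
        eulerSum q (-q * q ^ j) * eulerSumD q (y * q ^ (-j)) +
        (2 * j + e) * (eulerSum q (-q * q ^ j) * eulerSum q (y * q ^ (-j))))) := by
  have hm : ∀ {f g : ℕ → ℂ} {a b : ℂ}, HasSum f a → HasSum g b → Summable (fun n => ‖f n‖) →
      Summable (fun n => ‖g n‖) → HasSum (fun p : ℕ × ℕ => f p.1 * g p.2) (a * b) :=
    fun hf hg hf' hg' => hf.mul hg (summable_mul_of_summable_norm hf' hg')
  have h1 := hm (hasSum_eulerSumD hq (-q * q ^ j)) (hasSum_eulerSum hq (y * q ^ (-j)))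
    (summable_norm_eulerSumD hq _) (summable_norm_eulerSum hq _)
  have h2 := hm (hasSum_eulerSum hq (-q * q ^ j)) (hasSum_eulerSumD hq (y * q ^ (-j)))
    (summable_norm_eulerSum hq _) (summable_norm_eulerSumD hq _)
  have h3 := hm (hasSum_eulerSum hq (-q * q ^ j)) (hasSum_eulerSum hq (y * q ^ (-j)))
    (summable_norm_eulerSum hq _) (summable_norm_eulerSum hq _)
  refine (((h1.sub h2).add (h3.mul_left (2 * (j : ℂ) + e))).mul_left (q ^ (j * (j + e)))).congr_fun ?_
  rintro ⟨n, l⟩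
  simp only [thetaTerm]
  have : q ^ (j * (j + ((n : ℤ) - l + e))) = q ^ (j * (j + e)) * (q ^ j) ^ n * (q ^ (-j)) ^ l := by
    rw [← zpow_natCast, ← zpow_natCast, ← zpow_mul, ← zpow_mul, ← zpow_add₀ hq0, ← zpow_add₀ hq0]
    congr 1
    ring
  rw [this, mul_pow, mul_pow]
  push_cast
  ring

/-! ### Evaluation of the fibres over j. -/

/-- Reversing the product: since y = q/z, the factor 1 + y q^{i-j} is (1+w)/w with w = z q^{j-1-i},
and these w multiply to z^j q^{j(j-1)/2}. -/
theorem qPoch_reflect {q y z : ℂ} (hq0 : q ≠ 0) (hz0 : z ≠ 0) (hzy : z * y = q) (j : ℕ) :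
    qPoch (-(y * q ^ (-(j : ℤ)))) q j * (z ^ j * q ^ j.choose 2) = qPoch (-z) q j := by
  induction j with
  | zero => simp [qPoch]
  | succ j ih =>
    have h1 : -(y * q ^ (-((j + 1 : ℕ) : ℤ))) * q = -(y * q ^ (-(j : ℤ))) := by
      rw [zpow_neg, zpow_neg, zpow_natCast, zpow_natCast, pow_succ]
      field_simp
    rw [qPoch_succ_left, h1, qPoch_succ (-z), ← ih, Nat.choose_succ_succ' j 1, Nat.choose_one_right,
      zpow_neg, zpow_natCast, pow_add]
    have h2 : y = q / z := by rw [← hzy]; field_simp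
    rw [h2]
    field_simp
    ring

theorem one_add_mul_zpow_ne_zero {q y z : ℂ} (hq0 : q ≠ 0) (hz0 : z ≠ 0) (hzy : z * y = q)
    (h : ∀ i : ℕ, 1 + z * q ^ i ≠ 0) {i j : ℕ} (hij : i < j) :
    1 + y * q ^ (-(j : ℤ)) * q ^ i ≠ 0 := by
  obtain ⟨k, rfl⟩ := Nat.exists_eq_add_of_lt hij
  intro h0
  refine h k ?_
  have h2 : y = q / z := by rw [← hzy]; field_simp
  rw [h2, zpow_neg, zpow_natCast, pow_succ, pow_add] at h0
  field_simp at h0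
  linear_combination h0

/-- The same reversal for logarithmic derivatives: w⁻¹/(1+w⁻¹) = 1 - w/(1+w). -/
theorem sum_reflect {q y z : ℂ} (hq0 : q ≠ 0) (hz0 : z ≠ 0) (hzy : z * y = q)
    (h : ∀ i : ℕ, 1 + z * q ^ i ≠ 0) (j : ℕ) :
    ∑ i ∈ range j, y * q ^ (-(j : ℤ)) * q ^ i / (1 + y * q ^ (-(j : ℤ)) * q ^ i) =
      j - ∑ i ∈ range j, z * q ^ i / (1 + z * q ^ i) := by
  induction j with
  | zero => simp
  | succ j ih =>
    have h1 : ∀ i : ℕ, y * q ^ (-((j + 1 : ℕ) : ℤ)) * q ^ (i + 1) = y * q ^ (-(j : ℤ)) * q ^ i := by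
      intro i
      rw [zpow_neg, zpow_neg, zpow_natCast, zpow_natCast, pow_succ, pow_succ]
      field_simp
    have h3 := one_add_mul_zpow_ne_zero hq0 hz0 hzy h (Nat.succ_pos j)
    rw [sum_range_succ', sum_range_succ _ j]
    simp only [h1]
    rw [ih]
    have h4 : y * q ^ (-((j + 1 : ℕ) : ℤ)) * q ^ 0 / (1 + y * q ^ (-((j + 1 : ℕ) : ℤ)) * q ^ 0) =
        1 - z * q ^ j / (1 + z * q ^ j) := by
      have h5 := h j
      have h6 : y * q ^ (-((j + 1 : ℕ) : ℤ)) * q ^ 0 = 1 / (z * q ^ j) := by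
        have h2 : y = q / z := by rw [← hzy]; field_simp
        rw [h2, zpow_neg, zpow_natCast, pow_succ]
        field_simp
      rw [h6]
      have h7 : 1 + 1 / (z * q ^ j) = (1 + z * q ^ j) / (z * q ^ j) := by
        field_simp
        ring
      rw [h7]
      field_simp
      ring
    rw [h4]
    push_cast
    ring

theorem choose_two_add_choose_two (j : ℕ) : j.choose 2 + (j + 1).choose 2 = j * j := by
  induction j with
  | zero => simp
  | succ j ih =>
    rw [Nat.choose_succ_succ' (j + 1) 1, Nat.choose_succ_succ' j 1] at *
    simp only [Nat.choose_one_right] at *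
    linarith

/-- The contribution of an index `j ≥ 0` to the bilateral series. -/
theorem thetaFiber_nonneg {q y z : ℂ} (hq0 : q ≠ 0) (hq : ‖q‖ < 1) (hzy : z * y = q) {e : ℤ}
    (hz : z = q ^ e) (h : ∀ i : ℕ, 1 + z * q ^ i ≠ 0) (hE : eulerSum q (-q) ≠ 0)
    (hY : eulerSum q y ≠ 0) (j : ℕ) :
    q ^ ((j : ℤ) * (j + e)) * (eulerSumD q (-q * q ^ (j : ℤ)) * eulerSum q (y * q ^ (-(j : ℤ))) -
      eulerSum q (-q * q ^ (j : ℤ)) * eulerSumD q (y * q ^ (-(j : ℤ))) +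
      (2 * (j : ℤ) + e) * (eulerSum q (-q * q ^ (j : ℤ)) * eulerSum q (y * q ^ (-(j : ℤ))))) =
    eulerSum q (-q) * eulerSum q y * (q ^ (j + 1).choose 2 * qPoch (-z) q j / qPoch q q j *
      (e + eulerSumD q (-q) / eulerSum q (-q) - eulerSumD q y / eulerSum q y +
        (∑ i ∈ range j, z * q ^ i / (1 + z * q ^ i) + ∑ i ∈ range j, 1 / (1 - q ^ (i + 1))))) := by
  have hz0 : z ≠ 0 := by rw [hz]; exact zpow_ne_zero _ hq0
  have ha := qPoch_ne_zero q q hq hq j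
  have hyj : y * q ^ (-(j : ℤ)) * q ^ j = y := by
    rw [zpow_neg, zpow_natCast]; field_simp
  have e1 := eulerSum_eq_qPoch_mul hq (-q) j
  have d1 := eulerSumD_eq_qPoch_mul hq (-q) j fun i _ => by
    have := one_sub_pow_ne_zero hq i
    rwa [pow_succ', sub_eq_add_neg, ← neg_mul] at this
  have e2 := eulerSum_eq_qPoch_mul hq (y * q ^ (-(j : ℤ))) j
  have d2 := eulerSumD_eq_qPoch_mul hq (y * q ^ (-(j : ℤ))) j fun i hi =>
    one_add_mul_zpow_ne_zero hq0 hz0 hzy h hi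
  rw [hyj] at e2 d2
  rw [sum_reflect hq0 hz0 hzy h] at d2
  have s1 : ∑ i ∈ range j, -q * q ^ i / (1 + -q * q ^ i) =
      j - ∑ i ∈ range j, 1 / (1 - q ^ (i + 1)) := by
    have : ∀ i ∈ range j, -q * q ^ i / (1 + -q * q ^ i) = 1 - 1 / (1 - q ^ (i + 1)) := by
      intro i _
      have := one_sub_pow_ne_zero hq i
      rw [show 1 + -q * q ^ i = 1 - q ^ (i + 1) by ring]
      field_simp
      ring
    rw [sum_congr rfl this]
    simp
  rw [s1] at d1
  -- Here j² = j(j-1)/2 + j(j+1)/2 and z^j = q^{ej}: the reflection consumes one triangular power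
  -- and z^j, leaving the other.
  have hb : q ^ ((j : ℤ) * (j + e)) * qPoch (-(y * q ^ (-(j : ℤ)))) q j =
      q ^ (j + 1).choose 2 * qPoch (-z) q j := by
    rw [← qPoch_reflect hq0 hz0 hzy j]
    have : q ^ ((j : ℤ) * (j + e)) = z ^ j * (q ^ j.choose 2 * q ^ (j + 1).choose 2) := by
      rw [← pow_add, choose_two_add_choose_two, hz, ← zpow_natCast, ← zpow_natCast, ← zpow_mul,
        ← zpow_add₀ hq0]
      congr 1
      push_cast
      ring
    rw [this]
    ring
  rw [neg_neg] at e1 d1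
  rw [zpow_natCast]
  set E1 := eulerSum q (-q * q ^ j)
  set D1 := eulerSumD q (-q * q ^ j)
  set κ := ∑ i ∈ range j, z * q ^ i / (1 + z * q ^ i)
  set α := ∑ i ∈ range j, 1 / (1 - q ^ (i + 1))
  have e1' : E1 = eulerSum q (-q) / qPoch q q j := by rw [e1]; field_simp
  have d1' : D1 = (eulerSumD q (-q) - (j - α) * eulerSum q (-q)) / qPoch q q j := by
    rw [d1, e1]; field_simp; ring
  rw [e2, d2, d1', e1']
  push_cast
  field_simp
  -- The terms -(j-α) and -(j-κ) from the two reflections meet the weight 2j, so j cancels and α + κ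
  -- remains.
  linear_combination ((eulerSumD q (-q) - (j - α) * eulerSum q (-q)) * eulerSum q y -
    eulerSum q (-q) * (eulerSumD q y + (j - κ) * eulerSum q y) +
    (2 * j + e) * (eulerSum q (-q) * eulerSum q y)) * hb

theorem eulerSum_neg_zpow {q : ℂ} (hq0 : q ≠ 0) (hq : ‖q‖ < 1) (m : ℕ) :
    eulerSum q (-(q ^ m)⁻¹) = 0 := by
  rw [eulerSum_eq_qPoch_mul hq _ (m + 1), qPoch_succ]
  have : 1 - -(-(q ^ m)⁻¹) * q ^ m = 0 := by field_simp; ring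
  rw [this]
  simp

/-- The product has a simple zero here, so its derivative is the product of the remaining factors.
In the induction, the inhomogeneous term of `eulerSumD_eq` vanishes after the base case. -/
theorem eulerSumD_neg_zpow {q : ℂ} (hq0 : q ≠ 0) (hq : ‖q‖ < 1) (m : ℕ) :
    eulerSumD q (-(q ^ m)⁻¹) * q ^ (m + 1).choose 2 = (-1) ^ (m + 1) * (qPoch q q m * eulerSum q (-q)) := by
  induction m with
  | zero =>
    rw [eulerSumD_eq hq]
    simp [qPoch]
  | succ m ih =>
    have h1 : -(q ^ (m + 1))⁻¹ * q = -(q ^ m)⁻¹ := by rw [pow_succ]; field_simp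
    rw [eulerSumD_eq hq, h1, eulerSum_neg_zpow hq0 hq, qPoch_succ, Nat.choose_succ_succ' (m + 1) 1,
      Nat.choose_one_right, pow_add, mul_zero, add_zero, pow_succ (-1 : ℂ)]
    have h2 : (1 + -(q ^ (m + 1))⁻¹) * q ^ (m + 1) = -(1 - q ^ (m + 1)) := by
      field_simp; ring
    rw [← pow_succ']
    linear_combination (1 + -(q ^ (m + 1))⁻¹) * q ^ (m + 1) * ih +
      (-1) ^ (m + 1) * (qPoch q q m * eulerSum q (-q)) * h2

/-- The contribution of an index `j < 0` to the bilateral series. -/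
theorem thetaFiber_neg {q y z : ℂ} (hq0 : q ≠ 0) (hq : ‖q‖ < 1) {e : ℤ}
    (hz : z = q ^ e) (hY : eulerSum q y ≠ 0) (m : ℕ) :
    q ^ ((-(m + 1 : ℤ)) * (-(m + 1 : ℤ) + e)) * (eulerSumD q (-q * q ^ (-(m + 1 : ℤ))) *
        eulerSum q (y * q ^ (-(-(m + 1 : ℤ)))) -
      eulerSum q (-q * q ^ (-(m + 1 : ℤ))) * eulerSumD q (y * q ^ (-(-(m + 1 : ℤ)))) +
      (2 * ((-(m + 1 : ℤ) : ℤ) : ℂ) + e) * (eulerSum q (-q * q ^ (-(m + 1 : ℤ))) *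
        eulerSum q (y * q ^ (-(-(m + 1 : ℤ)))))) =
    eulerSum q (-q) * eulerSum q y * ((-1) ^ (m + 1) * qPoch q q m *
      (q ^ (m + 2).choose 2 / z ^ (m + 1)) / qPoch (-y) q (m + 1)) := by
  have h1 : -q * q ^ (-(m + 1 : ℤ)) = -(q ^ m)⁻¹ := by
    rw [zpow_neg, show (m + 1 : ℤ) = ((m + 1 : ℕ) : ℤ) by push_cast; rfl, zpow_natCast, pow_succ]
    field_simp
  have h2 : y * q ^ (-(-(m + 1 : ℤ))) = y * q ^ (m + 1) := by
    rw [neg_neg, show (m + 1 : ℤ) = ((m + 1 : ℕ) : ℤ) by push_cast; rfl, zpow_natCast]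
  have e2 := eulerSum_eq_qPoch_mul hq y (m + 1)
  have hP : qPoch (-y) q (m + 1) ≠ 0 := fun h => hY (by rw [e2, h, zero_mul])
  have d := eulerSumD_neg_zpow hq0 hq m
  -- Both terms containing E(-q^{-m}) drop out; only the one with its derivative survives.
  rw [h1, h2, eulerSum_neg_zpow hq0 hq]
  have h3 : q ^ ((-(m + 1 : ℤ)) * (-(m + 1 : ℤ) + e)) =
      q ^ (m + 1).choose 2 * (q ^ (m + 2).choose 2 / z ^ (m + 1)) := by
    rw [← mul_div_assoc, ← pow_add, choose_two_add_choose_two, hz, ← zpow_natCast, ← zpow_natCast,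
      ← zpow_mul, ← zpow_sub₀ hq0]
    congr 1
    push_cast
    ring
  rw [h3, e2]
  generalize eulerSumD q (-(q ^ m)⁻¹) = D at d ⊢
  generalize q ^ (m + 2).choose 2 / z ^ (m + 1) = R
  field_simp
  linear_combination R * eulerSum q (y * q ^ (m + 1)) * d

theorem summable_tsum_eq_of_hasSum_int {F : ℤ → ℂ} (hF : HasSum F 0) {f g : ℕ → ℂ} {C : ℂ}
    (hC : C ≠ 0) (hf : ∀ j : ℕ, F j = C * f j) (hg : ∀ m : ℕ, F (-(m + 1 : ℤ)) = C * -g m) :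
    Summable f ∧ ∑' j, f j = ∑' m, g m := by
  have hp := hF.summable.comp_injective Nat.cast_injective
  have hn := hF.summable.comp_injective (i := fun m : ℕ => (-(m + 1 : ℤ))) (fun a b hab => by
    simpa using hab)
  have ht := tsum_of_nat_of_neg_add_one hp hn
  rw [hF.tsum_eq] at ht
  simp only [Function.comp_def, hf] at hp
  simp only [hf, hg, tsum_mul_left, ← mul_add, tsum_neg] at ht
  exact ⟨(summable_mul_left_iff hC).1 hp,
    add_neg_eq_zero.1 ((mul_eq_zero.1 ht.symm).resolve_left hC)⟩

theorem summable_tsum_bilateral {q y z : ℂ} (hq0 : q ≠ 0) (hq : ‖q‖ < 1) (hzy : z * y = q) {e : ℤ}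
    (he : e = 0 ∨ e = 1) (hz : z = q ^ e) (h : ∀ i : ℕ, 1 + z * q ^ i ≠ 0)
    (hE : eulerSum q (-q) ≠ 0) (hY : eulerSum q y ≠ 0) (hy : ‖y‖ ≤ 1) :
    (Summable fun j : ℕ => q ^ (j + 1).choose 2 * qPoch (-z) q j / qPoch q q j *
      (e + eulerSumD q (-q) / eulerSum q (-q) - eulerSumD q y / eulerSum q y +
        (∑ i ∈ range j, z * q ^ i / (1 + z * q ^ i) + ∑ i ∈ range j, 1 / (1 - q ^ (i + 1))))) ∧
    ∑' j : ℕ, q ^ (j + 1).choose 2 * qPoch (-z) q j / qPoch q q j *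
      (e + eulerSumD q (-q) / eulerSum q (-q) - eulerSumD q y / eulerSum q y +
        (∑ i ∈ range j, z * q ^ i / (1 + z * q ^ i) + ∑ i ∈ range j, 1 / (1 - q ^ (i + 1)))) =
    ∑' m : ℕ, (-1) ^ m * qPoch q q m *
      (q ^ (m + 2).choose 2 / z ^ (m + 1)) / qPoch (-y) q (m + 1) := by
  have h1 := (summable_thetaTerm hq0 hq hy he).hasSum.prod_fiberwise
    (fun j => hasSum_thetaTerm_fiber hq0 hq y e j)
  rw [tsum_thetaTerm] at h1
  refine summable_tsum_eq_of_hasSum_int h1 (mul_ne_zero hE hY)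
    (fun j => thetaFiber_nonneg hq0 hq hzy hz h hE hY j) fun m => ?_
  rw [thetaFiber_neg hq0 hq hz hY m, pow_succ (-1 : ℂ)]
  ring

/-! ### Gaussian binomials and the finite q-binomial theorem. -/

theorem qBinom_zero_right {q : ℂ} (hq : ‖q‖ < 1) (n : ℕ) : qBinom q n 0 = 1 := by
  have := qPoch_ne_zero q q hq hq n
  simp [qBinom, qPoch_zero, this]

theorem qBinom_eq_zero (q : ℂ) {n m : ℕ} (h : n < m) : qBinom q n m = 0 := by
  simp [qBinom, h]

theorem qBinom_succ_succ {q : ℂ} (hq : ‖q‖ < 1) (n j : ℕ) :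
    qBinom q (n + 1) (j + 1) = qBinom q n j + q ^ (j + 1) * qBinom q n (j + 1) := by
  have hp := qPoch_ne_zero q q hq hq
  rcases lt_trichotomy n j with h | rfl | h
  · rw [qBinom_eq_zero q h, qBinom_eq_zero q (by omega), qBinom_eq_zero q (by omega)]
    simp
  · rw [qBinom_eq_zero q (Nat.lt_succ_self n)]
    simp [qBinom, qPoch_zero, hp]
  · obtain ⟨i, rfl⟩ := Nat.exists_eq_add_of_lt h
    rw [qBinom, qBinom, qBinom, if_pos (by omega), if_pos (by omega), if_pos (by omega),
      show j + i + 1 + 1 - (j + 1) = i + 1 by omega, show j + i + 1 - j = i + 1 by omega,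
      show j + i + 1 - (j + 1) = i by omega, qPoch_succ q q (j + i + 1), qPoch_succ q q j,
      qPoch_succ q q i]
    have h1 := hp j
    have h2 := hp i
    have h3 := one_sub_pow_ne_zero hq j
    have h4 := one_sub_pow_ne_zero hq i
    rw [pow_succ'] at h3 h4
    field_simp
    ring

/-- Pascal's rule with an arbitrary weight: d = 1 yields the q-binomial theorem, d(k) = k its
logarithmic derivative. -/
theorem sum_qBinom_succ {q : ℂ} (hq : ‖q‖ < 1) (z : ℂ) (d : ℕ → ℂ) (j : ℕ) :
    ∑ k ∈ range (j + 2), d k * (qBinom q (j + 1) k * z ^ k * q ^ k.choose 2) =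
      ∑ k ∈ range (j + 1), (d k + z * d (k + 1)) * (qBinom q j k * (z * q) ^ k * q ^ k.choose 2) := by
  have h1 : ∑ k ∈ range (j + 1), d k * (qBinom q j k * (z * q) ^ k * q ^ k.choose 2) =
      ∑ k ∈ range (j + 1), d (k + 1) *
        (q ^ (k + 1) * qBinom q j (k + 1) * z ^ (k + 1) * q ^ (k + 1).choose 2) + d 0 := by
    rw [sum_range_succ', sum_range_succ _ j, qBinom_eq_zero q (Nat.lt_succ_self j),
      qBinom_zero_right hq]
    simp only [mul_pow]
    simp
    exact sum_congr rfl fun k _ => by ring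
  simp only [add_mul, sum_add_distrib]
  rw [h1, sum_range_succ', qBinom_zero_right hq]
  simp only [qBinom_succ_succ hq, Nat.choose_succ_succ' _ 1, Nat.choose_one_right]
  rw [add_right_comm, ← sum_add_distrib]
  congr 1
  · exact sum_congr rfl fun k _ => by ring
  · simp

theorem sum_qBinom {q : ℂ} (hq : ‖q‖ < 1) (z : ℂ) (j : ℕ) :
    ∑ k ∈ range (j + 1), qBinom q j k * z ^ k * q ^ k.choose 2 = qPoch (-z) q j := by
  induction j generalizing z with
  | zero => simp [qPoch, qBinom_zero_right hq]
  | succ j ih =>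
    have h := sum_qBinom_succ hq z (fun _ => 1) j
    simp only [one_mul, mul_one] at h
    rw [h, ← mul_sum, ih, qPoch_succ_left]
    ring_nf

theorem sum_mul_qBinom {q : ℂ} (hq : ‖q‖ < 1) (z : ℂ) (j : ℕ) (hz : ∀ i : ℕ, 1 + z * q ^ i ≠ 0) :
    ∑ k ∈ range (j + 1), k * (qBinom q j k * z ^ k * q ^ k.choose 2) =
      qPoch (-z) q j * ∑ i ∈ range j, z * q ^ i / (1 + z * q ^ i) := by
  induction j generalizing z with
  | zero => simp
  | succ j ih =>
    have h := sum_qBinom_succ hq z (fun k => (k : ℂ)) j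
    have h2 : ∀ k : ℕ, (k : ℂ) + z * ((k + 1 : ℕ) : ℂ) = (1 + z) * k + z := fun k => by
      push_cast; ring
    simp only [h2] at h
    have hzq : ∀ i : ℕ, 1 + z * q * q ^ i ≠ 0 := fun i => by
      have := hz (i + 1); rwa [pow_succ', ← mul_assoc] at this
    have h0 : 1 + z ≠ 0 := by simpa using hz 0
    rw [h]
    have h3 : ∀ k X : ℂ, ((1 + z) * k + z) * X = (1 + z) * (k * X) + z * X := fun k X => by ring
    simp only [h3, sum_add_distrib]
    rw [← mul_sum, ← mul_sum, ih _ hzq, sum_qBinom hq, qPoch_succ_left, sum_range_succ']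
    simp only [pow_succ', ← mul_assoc, pow_zero, mul_one, sub_neg_eq_add, neg_mul]
    field_simp

/-! ### Tails of Gaussian binomials. -/

/-- The difference between `[n, j]` and its limit as `n → ∞`. -/
noncomputable def qBinomTail (q : ℂ) (j n : ℕ) : ℂ := 1 / qPoch q q j - qBinom q n j

theorem qBinomTail_of_lt (q : ℂ) {j n : ℕ} (h : n < j) : qBinomTail q j n = 1 / qPoch q q j := by
  rw [qBinomTail, qBinom_eq_zero q h, sub_zero]

theorem exists_norm_one_sub_qPoch_le {q : ℂ} (hq : ‖q‖ < 1) :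
    ∃ C : ℝ, 0 < C ∧ ∀ a : ℂ, ‖a‖ ≤ 1 → ∀ n, ‖1 - qPoch a q n‖ ≤ C * ‖a‖ := by
  obtain ⟨C, hC0, hC⟩ := exists_norm_qPoch_le q hq
  have h1 : 0 < 1 - ‖q‖ := by linarith
  refine ⟨C * (1 - ‖q‖)⁻¹, by positivity, fun a ha n => ?_⟩
  have key : ‖1 - qPoch a q n‖ ≤ C * ‖a‖ * ∑ i ∈ range n, ‖q‖ ^ i := by
    induction n with
    | zero => simp [qPoch]
    | succ n ih =>
      have : 1 - qPoch a q (n + 1) = (1 - qPoch a q n) + qPoch a q n * (a * q ^ n) := by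
        rw [qPoch_succ]; ring
      rw [this, sum_range_succ, mul_add]
      refine (norm_add_le _ _).trans (add_le_add ih ?_)
      rw [norm_mul, norm_mul, norm_pow, ← mul_assoc]
      gcongr
      exact hC a ha n
  refine key.trans ?_
  have h2 : ∑ i ∈ range n, ‖q‖ ^ i ≤ (1 - ‖q‖)⁻¹ := by
    rw [← tsum_geometric_of_lt_one (norm_nonneg q) hq]
    exact (summable_geometric_of_lt_one (norm_nonneg q) hq).sum_le_tsum _ fun i _ => by positivity
  calc _ ≤ C * ‖a‖ * (1 - ‖q‖)⁻¹ := by gcongr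
    _ = _ := by ring

/-- For n ≥ j the tail is (1 - (q^{n-j+1})_j)/(q)_j, of order |q|^{n-j}. The factor |q|^j makes the
bound uniform in j and covers n < j as well. -/
theorem exists_norm_qBinomTail_le {q : ℂ} (hq : ‖q‖ < 1) :
    ∃ C : ℝ, 0 < C ∧ ∀ j n, ‖qBinomTail q j n‖ * ‖q‖ ^ j ≤ C * ‖q‖ ^ n := by
  obtain ⟨C, hC0, hC⟩ := exists_norm_qPoch_inv_le q q (qPoch_ne_zero q q hq hq)
    (qPochInf_ne_zero q q hq hq) hq
  obtain ⟨D, hD0, hD⟩ := exists_norm_one_sub_qPoch_le hq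
  refine ⟨C * (D + 1), by positivity, fun j n => ?_⟩
  rcases lt_or_ge n j with h | h
  · rw [qBinomTail_of_lt q h, one_div]
    have : ‖q‖ ^ j ≤ ‖q‖ ^ n := pow_le_pow_of_le_one (norm_nonneg _) hq.le h.le
    calc _ ≤ C * ‖q‖ ^ n := mul_le_mul (hC j) this (by positivity) hC0.le
      _ ≤ _ := by
        gcongr
        exact le_mul_of_one_le_right hC0.le (by linarith)
  · obtain ⟨i, rfl⟩ := Nat.exists_eq_add_of_le' h
    have h1 : qBinomTail q j (i + j) = (qPoch q q j)⁻¹ * (1 - qPoch (q * q ^ i) q j) := by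
      have h2 := qPoch_ne_zero q q hq hq i
      have h3 := qPoch_ne_zero q q hq hq j
      rw [qBinomTail, qBinom, if_pos h, Nat.add_sub_cancel, qPoch_add]
      field_simp
    have hqi : ‖q * q ^ i‖ ≤ ‖q‖ ^ i := by
      rw [norm_mul, norm_pow]
      exact mul_le_of_le_one_left (by positivity) hq.le
    have h4 := hD (q * q ^ i) (hqi.trans (pow_le_one₀ (norm_nonneg _) hq.le)) j
    rw [h1, norm_mul, pow_add, ← mul_assoc (C * (D + 1))]
    refine mul_le_mul_of_nonneg_right ?_ (by positivity)
    rw [mul_assoc]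
    refine mul_le_mul (hC j) (h4.trans ?_) (norm_nonneg _) hC0.le
    gcongr
    linarith

/-- Tails obey Pascal's rule. If T_j is the sum, this reads T_{j+1} - 1/(q)_{j+1} = T_j + q^{j+1}
T_{j+1}, which is solved for T_{j+1}. -/
theorem hasSum_qBinomTail {q : ℂ} (hq0 : q ≠ 0) (hq : ‖q‖ < 1) (j : ℕ) :
    HasSum (qBinomTail q j) ((∑ i ∈ range j, 1 / (1 - q ^ (i + 1))) / qPoch q q j) := by
  obtain ⟨C, hC0, hC⟩ := exists_norm_qBinomTail_le hq
  have hs : ∀ j, Summable (qBinomTail q j) := fun j => by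
    have : 0 < ‖q‖ ^ j := pow_pos (norm_pos_iff.2 hq0) _
    refine Summable.of_norm_bounded (g := fun n => C / ‖q‖ ^ j * ‖q‖ ^ n)
      ((summable_geometric_of_lt_one (norm_nonneg q) hq).mul_left _) fun n => ?_
    rw [div_mul_eq_mul_div, le_div_iff₀ this]
    exact hC j n
  induction j with
  | zero =>
    have : qBinomTail q 0 = fun _ => 0 := by
      funext n
      simp [qBinomTail, qBinom_zero_right hq, qPoch_zero]
    rw [this]
    simp
  | succ j ih =>
    have h1 := (hasSum_nat_add_iff' 1).2 (hs (j + 1)).hasSum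
    have h2 := ih.add ((hs (j + 1)).hasSum.mul_left (q ^ (j + 1)))
    have hp := qPoch_ne_zero q q hq hq j
    have h3 := one_sub_pow_ne_zero hq j
    have hps : qPoch q q (j + 1) = qPoch q q j * (1 - q ^ (j + 1)) := by
      rw [qPoch_succ, pow_succ']
    have h4 : (fun n => qBinomTail q (j + 1) (n + 1)) =
        fun n => qBinomTail q j n + q ^ (j + 1) * qBinomTail q (j + 1) n := by
      funext n
      rw [qBinomTail, qBinomTail, qBinomTail, qBinom_succ_succ hq, hps]
      field_simp
      ring
    rw [h4] at h1
    have h5 := h1.unique h2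
    rw [sum_range_one, qBinomTail_of_lt q (Nat.succ_pos j)] at h5
    convert (hs (j + 1)).hasSum using 1
    rw [sum_range_succ, hps]
    rw [hps] at h5
    generalize ∑' n, qBinomTail q (j + 1) n = T at h5 ⊢
    field_simp at h5 ⊢
    linear_combination -h5

theorem hasSum_qBinomTail_sub {q : ℂ} (hq0 : q ≠ 0) (hq : ‖q‖ < 1) {j k : ℕ} (hk : k ≤ j) :
    HasSum (fun n => qBinomTail q j (n - k))
      ((k + ∑ i ∈ range j, 1 / (1 - q ^ (i + 1))) / qPoch q q j) := by
  refine (hasSum_nat_add_iff' k).1 ?_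
  simp only [Nat.add_sub_cancel]
  -- Truncated subtraction is harmless: i < k ≤ j forces i - k = 0 < j, so the binomial vanishes.
  -- These k terms account for the summand k.
  have : ∀ i ∈ range k, qBinomTail q j (i - k) = 1 / qPoch q q j := fun i hi => by
    rw [mem_range] at hi
    exact qBinomTail_of_lt q (by omega)
  rw [sum_congr rfl this, sum_const, card_range, nsmul_eq_mul, add_div, mul_one_div, add_sub_cancel_left]
  exact hasSum_qBinomTail hq0 hq j

/-! ### The sum of tails as a single series. -/

/-- The weight `[j, k] z ^ k q ^ (j(j+1)/2 + k(k-1)/2)` in the `q`-Pell sequences. -/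
noncomputable def pellWeight (q z : ℂ) (p : ℕ × ℕ) : ℂ :=
  qBinom q p.1 p.2 * z ^ p.2 * q ^ p.2.choose 2 * q ^ (p.1 + 1).choose 2

/-- The common generalization of the two `q`-Pell sequences. -/
noncomputable def pell (q z : ℂ) (n : ℕ) : ℂ :=
  ∑ j ∈ range (n + 1), ∑ k ∈ range (j + 1), pellWeight q z (j, k) * qBinom q (n - k) j

theorem hasSum_pell (q z : ℂ) (n : ℕ) :
    HasSum (fun p : ℕ × ℕ => pellWeight q z p * qBinom q (n - p.2) p.1) (pell q z n) := by
  have h : pell q z n = ∑ p ∈ range (n + 1) ×ˢ range (n + 1),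
      pellWeight q z p * qBinom q (n - p.2) p.1 := by
    rw [sum_product, pell]
    refine sum_congr rfl fun j hj => sum_subset (range_subset_range.2 (by simpa using hj)) ?_
    intro k _ hk
    rw [pellWeight, qBinom_eq_zero q (by simpa using hk)]
    simp
  rw [h]
  refine hasSum_sum_of_ne_finset_zero fun p hp => ?_
  simp only [mem_product, mem_range, not_and_or, not_lt] at hp
  rcases lt_or_ge p.1 p.2 with h1 | h1
  · rw [pellWeight, qBinom_eq_zero q h1]; simp
  · rw [qBinom_eq_zero q (n := n - p.2) (by omega)]; simp

theorem summable_pow_choose_two_mul_pow {q : ℂ} (hq : ‖q‖ < 1) {w : ℝ} (hw : 0 ≤ w) :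
    Summable fun k : ℕ => ‖q‖ ^ k.choose 2 * w ^ k := by
  obtain ⟨C, hC0, hC⟩ := exists_norm_qPoch_le q hq
  refine Summable.of_nonneg_of_le (fun k => by positivity) (fun k => ?_)
    ((summable_norm_eulerSum hq (w : ℂ)).mul_left C)
  have h := qPoch_ne_zero q q hq hq k
  have h1 : q ^ k.choose 2 * (w : ℂ) ^ k = qPoch q q k * (eulerCoeff q k * (w : ℂ) ^ k) := by
    rw [eulerCoeff]; field_simp
  have h2 : ‖q‖ ^ k.choose 2 * w ^ k = ‖q ^ k.choose 2 * (w : ℂ) ^ k‖ := by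
    simp [abs_of_nonneg hw]
  rw [h2, h1, norm_mul]
  gcongr
  exact hC q hq.le k

theorem exists_norm_pellWeight_le {q : ℂ} (hq : ‖q‖ < 1) {z : ℂ} (hz : ‖z‖ ≤ 1) :
    ∃ C : ℝ, 0 < C ∧ ∀ p : ℕ × ℕ,
      ‖pellWeight q z p‖ ≤ C * (‖q‖ ^ (p.1 + 1).choose 2 * ‖q‖ ^ p.2.choose 2) := by
  obtain ⟨C, hC0, hC⟩ := exists_norm_qPoch_inv_le q q (qPoch_ne_zero q q hq hq)
    (qPochInf_ne_zero q q hq hq) hq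
  obtain ⟨D, hD0, hD⟩ := exists_norm_qPoch_le q hq
  refine ⟨D * (C * C), by positivity, fun p => ?_⟩
  have hb : ‖qBinom q p.1 p.2‖ ≤ D * (C * C) := by
    rw [qBinom]
    split_ifs
    · rw [div_eq_mul_inv, mul_inv, norm_mul, norm_mul]
      gcongr
      · exact hD q hq.le _
      · exact hC _
      · exact hC _
    · rw [norm_zero]; positivity
  rw [pellWeight, norm_mul, norm_mul, norm_mul, norm_pow, norm_pow, norm_pow]
  calc _ ≤ D * (C * C) * 1 * ‖q‖ ^ p.2.choose 2 * ‖q‖ ^ (p.1 + 1).choose 2 := by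
        gcongr
        exact pow_le_one₀ (norm_nonneg _) hz
    _ = _ := by ring

theorem summable_pellWeight_div {q : ℂ} (hq : ‖q‖ < 1) {z : ℂ} (hz : ‖z‖ ≤ 1) :
    Summable fun p : ℕ × ℕ => pellWeight q z p / qPoch q q p.1 := by
  obtain ⟨C, hC0, hC⟩ := exists_norm_qPoch_inv_le q q (qPoch_ne_zero q q hq hq)
    (qPochInf_ne_zero q q hq hq) hq
  obtain ⟨D, hD0, hD⟩ := exists_norm_pellWeight_le hq hz
  have h1 : Summable fun k : ℕ => ‖q‖ ^ k.choose 2 := by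
    simpa using summable_pow_choose_two_mul_pow hq zero_le_one
  have h2 := ((summable_nat_add_iff 1).2 h1).mul_of_nonneg h1
    (fun _ => by positivity) (fun _ => by positivity)
  refine Summable.of_norm_bounded (h2.mul_left (D * C)) fun p => ?_
  rw [div_eq_mul_inv, norm_mul]
  calc _ ≤ D * (‖q‖ ^ (p.1 + 1).choose 2 * ‖q‖ ^ p.2.choose 2) * C :=
        mul_le_mul (hD p) (hC _) (norm_nonneg _) (by positivity)
    _ = _ := by ring

/-- The tail bound gives geometric decay in n at the cost of |q|^{-j-k}, which the quadratic
exponents of the weight absorb. -/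
theorem summable_pellWeight_mul_qBinomTail {q : ℂ} (hq0 : q ≠ 0) (hq : ‖q‖ < 1) {z : ℂ}
    (hz : ‖z‖ ≤ 1) : Summable fun x : ℕ × ℕ × ℕ =>
      pellWeight q z x.2 * qBinomTail q x.2.1 (x.1 - x.2.2) := by
  obtain ⟨C, hC0, hC⟩ := exists_norm_qBinomTail_le hq
  obtain ⟨D, hD0, hD⟩ := exists_norm_pellWeight_le hq hz
  have hr : 0 < ‖q‖ := norm_pos_iff.2 hq0
  have h1 : Summable fun k : ℕ => ‖q‖ ^ k.choose 2 := by
    simpa using summable_pow_choose_two_mul_pow hq zero_le_one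
  have h2 := (summable_geometric_of_lt_one (norm_nonneg q) hq).mul_of_nonneg
    (h1.mul_of_nonneg (summable_pow_choose_two_mul_pow hq (w := ‖q‖⁻¹) (by positivity))
    (fun _ => by positivity) (fun _ => by positivity))
    (fun _ => by positivity) (fun _ => by positivity)
  refine Summable.of_norm_bounded (h2.mul_left (D * C)) ?_
  rintro ⟨n, j, k⟩
  have h3 : ‖qBinomTail q j (n - k)‖ ≤ C * ‖q‖ ^ n * (‖q‖⁻¹) ^ k * (‖q‖⁻¹) ^ j := by
    have h4 : ‖q‖ ^ (n - k) ≤ ‖q‖ ^ n * (‖q‖⁻¹) ^ k := by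
      rw [inv_pow, ← div_eq_mul_inv, le_div_iff₀ (by positivity), ← pow_add]
      exact pow_le_pow_of_le_one hr.le hq.le (by omega)
    rw [inv_pow _ j, ← div_eq_mul_inv, le_div_iff₀ (by positivity), mul_assoc C]
    exact (hC j (n - k)).trans (by gcongr)
  rw [norm_mul]
  calc _ ≤ D * (‖q‖ ^ (j + 1).choose 2 * ‖q‖ ^ k.choose 2) *
        (C * ‖q‖ ^ n * (‖q‖⁻¹) ^ k * (‖q‖⁻¹) ^ j) :=
        mul_le_mul (hD (j, k)) h3 (norm_nonneg _) (by positivity)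
    _ = _ := by
      rw [Nat.choose_succ_succ' j 1, Nat.choose_one_right, pow_add, inv_pow, inv_pow]
      field_simp

theorem hasSum_pellWeight_mul (q z : ℂ) (j : ℕ) (d : ℕ → ℂ) :
    HasSum (fun k => pellWeight q z (j, k) * d k) (q ^ (j + 1).choose 2 *
      ∑ k ∈ range (j + 1), d k * (qBinom q j k * z ^ k * q ^ k.choose 2)) := by
  have h : HasSum (fun k => pellWeight q z (j, k) * d k)
      (∑ k ∈ range (j + 1), pellWeight q z (j, k) * d k) :=
    hasSum_sum_of_ne_finset_zero fun k hk => by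
      rw [pellWeight, qBinom_eq_zero q (by simpa using hk)]
      simp
  convert h using 1
  rw [mul_sum]
  refine sum_congr rfl fun k _ => ?_
  simp only [pellWeight]
  ring

theorem hasSum_pellWeight_div_fiber {q : ℂ} (hq : ‖q‖ < 1) (z : ℂ) (j : ℕ) :
    HasSum (fun k => pellWeight q z (j, k) / qPoch q q j)
      (q ^ (j + 1).choose 2 * qPoch (-z) q j / qPoch q q j) := by
  have h := (hasSum_pellWeight_mul q z j fun _ => 1).div_const (qPoch q q j)
  simpa only [one_mul, mul_one, sum_qBinom hq] using h

/-- Lebesgue's series as a double sum. -/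
theorem hasSum_lebesgue_double {q : ℂ} (hq : ‖q‖ < 1) {z : ℂ} (hz : ‖z‖ ≤ 1) :
    HasSum (fun j : ℕ => q ^ (j + 1).choose 2 * qPoch (-z) q j / qPoch q q j)
      (∑' p : ℕ × ℕ, pellWeight q z p / qPoch q q p.1) :=
  (summable_pellWeight_div hq hz).hasSum.prod_fiberwise fun j => hasSum_pellWeight_div_fiber hq z j

theorem hasSum_pellWeight_mul_tail_fiber {q : ℂ} (hq : ‖q‖ < 1) {z : ℂ}
    (h : ∀ i : ℕ, 1 + z * q ^ i ≠ 0) (j : ℕ) :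
    HasSum (fun k : ℕ => pellWeight q z (j, k) *
        ((k + ∑ i ∈ range j, 1 / (1 - q ^ (i + 1))) / qPoch q q j))
      (q ^ (j + 1).choose 2 * qPoch (-z) q j / qPoch q q j *
        (∑ i ∈ range j, z * q ^ i / (1 + z * q ^ i) + ∑ i ∈ range j, 1 / (1 - q ^ (i + 1)))) := by
  generalize ∑ i ∈ range j, 1 / (1 - q ^ (i + 1)) = α
  have h1 := (hasSum_pellWeight_mul q z j fun k => (k : ℂ) + α).div_const (qPoch q q j)
  simp only [add_mul, sum_add_distrib, ← mul_sum, sum_mul_qBinom hq z j h, sum_qBinom hq] at h1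
  have e : q ^ (j + 1).choose 2 * qPoch (-z) q j / qPoch q q j *
        (∑ i ∈ range j, z * q ^ i / (1 + z * q ^ i) + α) = q ^ (j + 1).choose 2 *
      (qPoch (-z) q j * ∑ i ∈ range j, z * q ^ i / (1 + z * q ^ i) + α * qPoch (-z) q j) /
        qPoch q q j := by ring
  rw [e]
  simpa only [mul_div_assoc] using h1

theorem hasSum_pellWeight_mul_tail {q : ℂ} (hq0 : q ≠ 0) (hq : ‖q‖ < 1) (z : ℂ) (p : ℕ × ℕ) :
    HasSum (fun n : ℕ => pellWeight q z p * qBinomTail q p.1 (n - p.2))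
      (pellWeight q z p * ((p.2 + ∑ i ∈ range p.1, 1 / (1 - q ^ (i + 1))) / qPoch q q p.1)) := by
  rcases lt_or_ge p.1 p.2 with hp | hp
  · have : pellWeight q z p = 0 := by rw [pellWeight, qBinom_eq_zero q hp]; simp
    simp [this, hasSum_zero]
  · exact (hasSum_qBinomTail_sub hq0 hq hp).mul_left _

theorem hasSum_pellWeight_mul_tail_index {q : ℂ} (hq : ‖q‖ < 1) {z : ℂ} (hz : ‖z‖ ≤ 1) (n : ℕ) :
    HasSum (fun p : ℕ × ℕ => pellWeight q z p * qBinomTail q p.1 (n - p.2))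
      ((∑' p : ℕ × ℕ, pellWeight q z p / qPoch q q p.1) - pell q z n) := by
  refine ((summable_pellWeight_div hq hz).hasSum.sub (hasSum_pell q z n)).congr_fun fun p => ?_
  simp only [qBinomTail]
  ring

/-- One triple series summed in two orders: with n outermost it gives the tails, with n innermost
the closed weights. -/
theorem hasSum_pell_tails {q : ℂ} (hq0 : q ≠ 0) (hq : ‖q‖ < 1) {z : ℂ} (hz : ‖z‖ ≤ 1)
    (h : ∀ i : ℕ, 1 + z * q ^ i ≠ 0) :
    HasSum (fun n => (∑' j : ℕ, q ^ (j + 1).choose 2 * qPoch (-z) q j / qPoch q q j) - pell q z n)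
      (∑' j : ℕ, q ^ (j + 1).choose 2 * qPoch (-z) q j / qPoch q q j *
        (∑ i ∈ range j, z * q ^ i / (1 + z * q ^ i) + ∑ i ∈ range j, 1 / (1 - q ^ (i + 1)))) := by
  have hs := (summable_pellWeight_mul_qBinomTail hq0 hq hz).hasSum
  rw [(hasSum_lebesgue_double hq hz).tsum_eq]
  have h1 := hs.prod_fiberwise fun n => hasSum_pellWeight_mul_tail_index hq hz n
  have h2 := ((Equiv.prodComm (ℕ × ℕ) ℕ).hasSum_iff.2 hs).prod_fiberwise
    fun p => hasSum_pellWeight_mul_tail hq0 hq z p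
  have h3 := h2.prod_fiberwise fun j => hasSum_pellWeight_mul_tail_fiber hq h j
  rwa [h3.tsum_eq]

/-! ### Lebesgue's identity. -/

theorem qPoch_mul_neg_qPoch (q : ℂ) (n : ℕ) :
    qPoch q q n * qPoch (-q) q n = qPoch (q ^ 2) (q ^ 2) n := by
  simp only [qPoch, ← prod_mul_distrib]
  exact prod_congr rfl fun i _ => by ring

theorem qPoch_two_mul (q : ℂ) (n : ℕ) :
    qPoch q q (2 * n) = qPoch q (q ^ 2) n * qPoch (q ^ 2) (q ^ 2) n := by
  induction n with
  | zero => simp [qPoch]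
  | succ n ih =>
    rw [show 2 * (n + 1) = 2 * n + 1 + 1 by ring, qPoch_succ, qPoch_succ, ih, qPoch_succ, qPoch_succ]
    ring

theorem norm_sq_lt_one {q : ℂ} (hq : ‖q‖ < 1) : ‖q ^ 2‖ < 1 := by
  rw [norm_pow]; exact pow_lt_one₀ (norm_nonneg _) hq two_ne_zero

/-- Euler's identity `(-q; q)_∞ (q; q²)_∞ = 1`. -/
theorem qPochInf_neg_mul_qPochInf_sq {q : ℂ} (hq : ‖q‖ < 1) :
    qPochInf (-q) q * qPochInf q (q ^ 2) = 1 := by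
  -- Take the limit of (q;q)_{2n} = (q;q²)_n (q)_n (-q)_n and cancel (q)_∞.
  have h1 := (tendsto_qPoch q q hq).comp (tendsto_id.const_mul_atTop' (r := 2) two_pos)
  have h2 := (tendsto_qPoch q (q ^ 2) (norm_sq_lt_one hq)).mul
    ((tendsto_qPoch q q hq).mul (tendsto_qPoch (-q) q hq))
  have h3 : ((qPoch q q) ∘ fun n => 2 * id n) =
      fun n => qPoch q (q ^ 2) n * (qPoch q q n * qPoch (-q) q n) := by
    funext n
    simp only [Function.comp, id, qPoch_mul_neg_qPoch, qPoch_two_mul]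
  rw [h3] at h1
  have h4 := tendsto_nhds_unique h1 h2
  have h5 := qPochInf_ne_zero q q hq hq
  refine mul_left_cancel₀ h5 ?_
  linear_combination -h4

theorem eulerSum_ne_zero {q y : ℂ} (hq : ‖q‖ < 1) (hy : ‖y‖ < 1) : eulerSum q y ≠ 0 := by
  rw [eulerSum_eq_qPochInf hq]
  exact qPochInf_ne_zero _ q (by rwa [norm_neg]) hq

theorem choose_two_add (i k : ℕ) :
    (i + k + 1).choose 2 = i.choose 2 + i * (k + 1) + (k + 1).choose 2 := by
  induction i with
  | zero => simp
  | succ i ih =>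
    rw [show i + 1 + k + 1 = i + k + 1 + 1 by ring, Nat.choose_succ_succ' _ 1,
      Nat.choose_succ_succ' i 1, ih, Nat.choose_one_right, Nat.choose_one_right]
    ring

/-- With j = i + k the sum is Euler's series at q^{k+1}, which is E(q)/(-q)_k. Since (q)_k (-q)_k =
(q²;q²)_k, an Euler coefficient in base q² appears, ready for the sum over k. -/
theorem hasSum_pellWeight_div_column {q : ℂ} (hq : ‖q‖ < 1) (z : ℂ) (k : ℕ) :
    HasSum (fun j => pellWeight q z (j, k) / qPoch q q j)
      (eulerSum q q * (eulerCoeff (q ^ 2) k * (z * q) ^ k)) := by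
  have hp := qPoch_ne_zero q q hq hq
  have hpn : qPoch (-q) q k ≠ 0 := qPoch_ne_zero (-q) q (by rwa [norm_neg]) hq k
  have hz : ∑ j ∈ range k, pellWeight q z (j, k) / qPoch q q j = 0 := by
    refine sum_eq_zero fun j hj => ?_
    rw [pellWeight, qBinom_eq_zero q (by simpa using hj)]
    simp
  refine (hasSum_nat_add_iff' k).1 ?_
  rw [hz, sub_zero, eulerSum_eq_qPoch_mul hq q k, ← pow_succ', eulerCoeff, ← qPoch_mul_neg_qPoch]
  have h1 := (hasSum_eulerSum hq (q ^ (k + 1))).mul_left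
    (z ^ k * q ^ k.choose 2 * q ^ (k + 1).choose 2 / qPoch q q k)
  have h2 : qPoch (-q) q k * eulerSum q (q ^ (k + 1)) *
      ((q ^ 2) ^ k.choose 2 / (qPoch q q k * qPoch (-q) q k) * (z * q) ^ k) =
      z ^ k * q ^ k.choose 2 * q ^ (k + 1).choose 2 / qPoch q q k * eulerSum q (q ^ (k + 1)) := by
    have := hp k
    rw [Nat.choose_succ_succ' k 1, Nat.choose_one_right]
    field_simp
    ring
  rw [h2]
  refine h1.congr_fun fun i => ?_
  have h3 := hp k
  have h4 := hp i
  have h5 := hp (i + k)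
  simp only [pellWeight, qBinom, if_pos (Nat.le_add_left k i), Nat.add_sub_cancel, eulerCoeff]
  rw [choose_two_add, pow_add, pow_add, mul_comm i (k + 1), pow_mul]
  field_simp

/-- Lebesgue's identity. -/
theorem tsum_lebesgue {q : ℂ} (hq : ‖q‖ < 1) {z : ℂ} (hz : ‖z‖ ≤ 1) :
    ∑' j : ℕ, q ^ (j + 1).choose 2 * qPoch (-z) q j / qPoch q q j =
      qPochInf (-(z * q)) (q ^ 2) / qPochInf q (q ^ 2) := by
  have h1 := ((Equiv.prodComm ℕ ℕ).hasSum_iff.2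
    (summable_pellWeight_div hq hz).hasSum).prod_fiberwise
    fun k => hasSum_pellWeight_div_column hq z k
  have h2 := (hasSum_eulerSum (norm_sq_lt_one hq) (z * q)).mul_left (eulerSum q q)
  have h3 := qPochInf_neg_mul_qPochInf_sq hq
  have h4 := qPochInf_ne_zero q (q ^ 2) hq (norm_sq_lt_one hq)
  rw [(hasSum_lebesgue_double hq hz).tsum_eq, h1.unique h2, eulerSum_eq_qPochInf hq,
    eulerSum_eq_qPochInf (norm_sq_lt_one hq), eq_div_iff h4]
  linear_combination qPochInf (-(z * q)) (q ^ 2) * h3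

/-! ### The Lambert series and the constant term. -/

theorem summable_lambert {q : ℂ} (hq : ‖q‖ < 1) :
    Summable fun p : ℕ × ℕ => q ^ ((p.1 + 1) * (2 * p.2 + 1)) := by
  have h := (summable_geometric_of_lt_one (norm_nonneg q) hq).mul_of_nonneg
    (summable_geometric_of_lt_one (norm_nonneg q) hq) (fun _ => by positivity)
    (fun _ => by positivity)
  refine Summable.of_norm_bounded h fun p => ?_
  rw [norm_pow, ← pow_add]
  exact pow_le_pow_of_le_one (norm_nonneg _) hq.le (by nlinarith [Nat.zero_le (p.1 * p.2)])

theorem norm_pow_succ_lt_one {q : ℂ} (hq : ‖q‖ < 1) (n : ℕ) : ‖q ^ (n + 1)‖ < 1 := by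
  rw [norm_pow]; exact pow_lt_one₀ (norm_nonneg _) hq n.succ_ne_zero

theorem hasSum_lambert_odd {q : ℂ} (hq : ‖q‖ < 1) :
    HasSum (fun n : ℕ => q ^ (2 * n + 1) / (1 - q ^ (2 * n + 1)))
      (∑' p : ℕ × ℕ, q ^ ((p.1 + 1) * (2 * p.2 + 1))) := by
  refine ((Equiv.prodComm ℕ ℕ).hasSum_iff.2 (summable_lambert hq).hasSum).prod_fiberwise fun r => ?_
  refine ((hasSum_geometric_of_norm_lt_one (norm_pow_succ_lt_one hq (2 * r))).mul_left
    (q ^ (2 * r + 1))).congr_fun fun i => ?_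
  simp only [Function.comp, Equiv.prodComm_apply, Prod.swap]
  rw [← pow_mul, ← pow_add]
  congr 1
  ring

/-- The double series of `hasSum_lambert_odd` summed in the other order. This form matches -x/(1-x)
- x/(1+x) = -2x/(1-x²), x = q^{i+1}. -/
theorem hasSum_lambert_even {q : ℂ} (hq : ‖q‖ < 1) :
    HasSum (fun i : ℕ => q ^ (i + 1) / (1 - (q ^ (i + 1)) ^ 2))
      (∑' n : ℕ, q ^ (2 * n + 1) / (1 - q ^ (2 * n + 1))) := by
  rw [(hasSum_lambert_odd hq).tsum_eq]
  refine (summable_lambert hq).hasSum.prod_fiberwise fun i => ?_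
  refine ((hasSum_geometric_of_norm_lt_one (norm_sq_lt_one (norm_pow_succ_lt_one hq i))).mul_left
    (q ^ (i + 1))).congr_fun fun r => ?_
  simp only
  rw [← pow_mul, ← pow_mul, ← pow_add]
  congr 1
  ring

theorem one_add_mul_pow_ne_zero {q y : ℂ} (hq : ‖q‖ < 1) (hy : ‖y‖ < 1) (i : ℕ) :
    1 + y * q ^ i ≠ 0 := by
  have := qPoch_ne_zero (-y) q (by rwa [norm_neg]) hq (i + 1)
  rw [qPoch_succ] at this
  simpa using (mul_ne_zero_iff.1 this).2

/-- The difference of the logarithmic derivatives of `(-y; q)_∞` at `-q` and `q`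
as a Lambert series. -/
theorem eulerSumD_div_sub {q : ℂ} (hq : ‖q‖ < 1) :
    eulerSumD q (-q) / eulerSum q (-q) - eulerSumD q q / eulerSum q q =
      -(2 * ∑' n : ℕ, q ^ (2 * n + 1) / (1 - q ^ (2 * n + 1))) := by
  have hq' : ‖-q‖ < 1 := by rwa [norm_neg]
  rw [eulerSumD_eq_mul_tsum hq (-q) (one_add_mul_pow_ne_zero hq hq'),
    eulerSumD_eq_mul_tsum hq q (one_add_mul_pow_ne_zero hq hq),
    mul_div_cancel_left₀ _ (eulerSum_ne_zero hq hq'), mul_div_cancel_left₀ _ (eulerSum_ne_zero hq hq)]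
  have h1 := (summable_mul_pow_div hq (-q)).hasSum.sub (summable_mul_pow_div hq q).hasSum
  have h2 := ((hasSum_lambert_even hq).mul_left 2).neg
  refine h1.unique (h2.congr_fun fun i => ?_)
  have h3 := one_add_mul_pow_ne_zero hq hq' i
  have h4 := one_add_mul_pow_ne_zero hq hq i
  rw [neg_mul, ← sub_eq_add_neg] at h3
  rw [neg_mul, ← sub_eq_add_neg, pow_succ']
  generalize q * q ^ i = x at h3 h4 ⊢
  rw [show 1 - x ^ 2 = (1 - x) * (1 + x) by ring]
  field_simp
  ring

/-- The extra factor 1 + y contributes y/(1+y) = 1/2 at y = 1. -/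
theorem eulerSumD_div_sub_one {q : ℂ} (hq : ‖q‖ < 1) :
    eulerSumD q 1 / eulerSum q 1 = 1 / 2 + eulerSumD q q / eulerSum q q := by
  have h := eulerSum_ne_zero hq hq
  rw [eulerSumD_eq hq, eulerSum_eq hq 1, one_mul]
  field_simp
  ring

theorem summable_qPoch_div_qPoch {q : ℂ} (hq : ‖q‖ < 1) (c : ℕ) {f : ℕ → ℕ} (hf : ∀ n, n ≤ f n) :
    Summable fun n : ℕ => qPoch q q n * (-1) ^ n * q ^ f n / qPoch (-q) q (n + c) := by
  have hq' : ‖-q‖ < 1 := by rwa [norm_neg]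
  obtain ⟨C, hC0, hC⟩ := exists_norm_qPoch_inv_le (-q) q (qPoch_ne_zero (-q) q hq' hq)
    (qPochInf_ne_zero (-q) q hq' hq) hq
  obtain ⟨D, hD0, hD⟩ := exists_norm_qPoch_le q hq
  refine Summable.of_norm_bounded
    ((summable_geometric_of_lt_one (norm_nonneg q) hq).mul_left (D * C)) fun n => ?_
  rw [div_eq_mul_inv, norm_mul, norm_mul, norm_mul, norm_pow, norm_pow, norm_neg, norm_one, one_pow,
    mul_one]
  calc _ ≤ D * ‖q‖ ^ n * C := by
        gcongr ?_ * ?_ * ?_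
        · exact hD q hq.le n
        · exact pow_le_pow_of_le_one (norm_nonneg _) hq.le (hf n)
        · exact hC _
    _ = _ := by ring

/-! ### The closed form and its two specializations. -/

/-- The sum of tails for the common generalization of the `q`-Pell sequences. -/
theorem hasSum_pell_tails_closed {q y z : ℂ} (hq0 : q ≠ 0) (hq : ‖q‖ < 1) (hzy : z * y = q) {e : ℤ}
    (he : e = 0 ∨ e = 1) (hz : z = q ^ e) (hz1 : ‖z‖ ≤ 1) (h : ∀ i : ℕ, 1 + z * q ^ i ≠ 0)
    (hY : eulerSum q y ≠ 0) (hy : ‖y‖ ≤ 1) :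
    HasSum (fun n => qPochInf (-(z * q)) (q ^ 2) / qPochInf q (q ^ 2) - pell q z n)
      (qPochInf (-(z * q)) (q ^ 2) / qPochInf q (q ^ 2) *
        -(e + eulerSumD q (-q) / eulerSum q (-q) - eulerSumD q y / eulerSum q y) +
      ∑' m : ℕ, (-1) ^ m * qPoch q q m *
        (q ^ (m + 2).choose 2 / z ^ (m + 1)) / qPoch (-y) q (m + 1)) := by
  have hE : eulerSum q (-q) ≠ 0 := eulerSum_ne_zero hq (by rwa [norm_neg])
  obtain ⟨h1, h2⟩ := summable_tsum_bilateral hq0 hq hzy he hz h hE hY hy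
  have h3 := hasSum_pell_tails hq0 hq hz1 h
  rw [tsum_lebesgue hq hz1] at h3
  rw [← h2]
  generalize e + eulerSumD q (-q) / eulerSum q (-q) - eulerSumD q y / eulerSum q y = c at h1 ⊢
  -- Subtracting c times Lebesgue's series from the bilateral identity leaves exactly the weights
  -- S_j.
  have h4 := (hasSum_lebesgue_double hq hz1).summable.hasSum.mul_right (-c)
  rw [tsum_lebesgue hq hz1] at h4
  have h5 := h4.add h1.hasSum
  rw [← h5.tsum_eq]
  convert h3 using 1
  refine tsum_congr fun j => ?_
  ring

theorem pellOmega_eq (q : ℂ) (n : ℕ) : pellOmega q n = pell q q n := by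
  refine sum_congr rfl fun j _ => sum_congr rfl fun k _ => ?_
  have h1 := Nat.choose_two_right (j + 1)
  have h2 := Nat.choose_two_right (k + 1)
  rw [Nat.add_sub_cancel, mul_comm] at h1 h2
  rw [← h1, ← h2, Nat.choose_succ_succ' k 1, Nat.choose_one_right]
  simp only [pellWeight]
  ring

theorem pellTheta_eq (q : ℂ) (n : ℕ) : pellTheta q n = pell q 1 n := by
  refine sum_congr rfl fun j _ => sum_congr rfl fun k _ => ?_
  have h1 := Nat.choose_two_right (j + 1)
  rw [Nat.add_sub_cancel, mul_comm] at h1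
  rw [← h1, ← Nat.choose_two_right]
  simp only [pellWeight]
  ring

theorem pell_zero {z : ℂ} (n : ℕ) : pell 0 z n = 1 := by
  rw [pell, sum_range_succ', sum_eq_zero]
  · simp [pellWeight, qBinom_zero_right]
  · intro j _
    refine sum_eq_zero fun k _ => ?_
    have : (j + 1 + 1).choose 2 ≠ 0 := (Nat.choose_pos (by omega)).ne'
    simp [pellWeight, this]

theorem qPochInf_zero_left (q : ℂ) : qPochInf 0 q = 1 := by simp [qPochInf]

theorem theorem1 (q : ℂ) (hq : ‖q‖ < 1) :
    -- the series on the two right-hand sides converge absolutely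
    (Summable fun n : ℕ => q ^ (2 * n + 1) / (1 - q ^ (2 * n + 1))) ∧
    (Summable fun n : ℕ =>
      qPoch q q n * (-1) ^ n * q ^ (n * (n + 1) / 2) / qPoch (-q) q n) ∧
    (Summable fun n : ℕ =>
      qPoch q q n * (-1) ^ n * q ^ ((n + 1) * (n + 2) / 2) / qPoch (-q) q (n + 1)) ∧
    -- the sum of tails for `ω_n(q)`
    HasSum
      (fun n : ℕ => qPochInf (-q ^ 2) (q ^ 2) / qPochInf q (q ^ 2) - pellOmega q n)
      (qPochInf (-q ^ 2) (q ^ 2) / qPochInf q (q ^ 2) *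
          (-(1 / 2) + 2 * ∑' n : ℕ, q ^ (2 * n + 1) / (1 - q ^ (2 * n + 1))) +
        1 / 2 * ∑' n : ℕ,
          qPoch q q n * (-1) ^ n * q ^ (n * (n + 1) / 2) / qPoch (-q) q n) ∧
    -- the sum of tails for `Θ_n(q)`; the last series is
    -- `∑_{m ≥ 1} (q)_{m-1} (-1)^{m-1} q^{m(m+1)/2} / (-q)_m` with `m = n + 1`
    HasSum
      (fun n : ℕ => qPochInf (-q) (q ^ 2) / qPochInf q (q ^ 2) - pellTheta q n)
      (2 * (qPochInf (-q) (q ^ 2) / qPochInf q (q ^ 2)) *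
          (∑' n : ℕ, q ^ (2 * n + 1) / (1 - q ^ (2 * n + 1))) +
        ∑' n : ℕ,
          qPoch q q n * (-1) ^ n * q ^ ((n + 1) * (n + 2) / 2) / qPoch (-q) q (n + 1)) := by
  refine ⟨(hasSum_lambert_odd hq).summable, ?_, ?_, ?_, ?_⟩
  · refine summable_qPoch_div_qPoch hq 0 fun n => ?_
    rw [Nat.le_div_iff_mul_le two_pos]
    rcases n with _ | n <;> nlinarith
  · refine summable_qPoch_div_qPoch hq 1 fun n => ?_
    rw [Nat.le_div_iff_mul_le two_pos]
    nlinarith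
  · simp only [pellOmega_eq]
    -- The bilateral argument uses negative powers of q, so q = 0 is checked directly.
    rcases eq_or_ne q 0 with rfl | hq0
    · have h1 : ∑' n : ℕ, qPoch (0 : ℂ) 0 n * (-1) ^ n * 0 ^ (n * (n + 1) / 2) / qPoch (-0) 0 n = 1 := by
        rw [tsum_eq_single 0 fun n hn => ?_]
        · simp [qPoch]
        · have : n * (n + 1) / 2 ≠ 0 :=
            (Nat.div_pos (by nlinarith [Nat.pos_of_ne_zero hn]) two_pos).ne'
          simp [this]
      rw [h1]
      simp [pell_zero, qPochInf_zero_left, hasSum_zero]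
    · have hh := hasSum_pell_tails_closed hq0 hq (y := 1) (mul_one q) (e := 1) (Or.inr rfl)
        (zpow_one q).symm hq.le (one_add_mul_pow_ne_zero hq hq)
        (by
          rw [eulerSum_eq hq, one_mul]
          exact mul_ne_zero (by norm_num) (eulerSum_ne_zero hq hq)) (by simp)
      rw [eulerSumD_div_sub_one hq, ← sq] at hh
      have hl := eulerSumD_div_sub hq
      convert hh using 2
      · congr 1
        push_cast
        linear_combination hl
      · rw [← tsum_mul_left]
        refine tsum_congr fun n => ?_
        have h1 := Nat.choose_two_right (n + 1)
        rw [Nat.add_sub_cancel, mul_comm] at h1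
        -- The factor 1/2 of the alternating series comes from (-1)_{n+1} = 2 (-q)_n, and dividing
        -- by z^{n+1} = q^{n+1} lowers the triangular exponent.
        rw [← h1, Nat.choose_succ_succ' (n + 1) 1, Nat.choose_one_right, qPoch_succ_left, pow_add,
          mul_div_cancel_left₀ _ (pow_ne_zero _ hq0)]
        rw [neg_one_mul]
        have := qPoch_ne_zero (-q) q (by rwa [norm_neg]) hq n
        field_simp
        ring
  · simp only [pellTheta_eq]
    rcases eq_or_ne q 0 with rfl | hq0
    · have h1 : ∀ n : ℕ, (n + 1) * (n + 2) / 2 ≠ 0 := fun n =>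
        (Nat.div_pos (by nlinarith) two_pos).ne'
      simp [pell_zero, qPochInf_zero_left, hasSum_zero, h1]
    · have hh := hasSum_pell_tails_closed hq0 hq (y := q) (one_mul q) (e := 0) (Or.inl rfl)
        (zpow_zero q).symm (by simp) (fun i => by simpa using one_add_pow_ne_zero hq i)
        (eulerSum_ne_zero hq hq) hq.le
      have hl := eulerSumD_div_sub hq
      rw [one_mul] at hh
      convert hh using 2
      · rw [Int.cast_zero, zero_add, hl]
        ring
      · refine tsum_congr fun n => ?_
        have h1 := Nat.choose_two_right (n + 2)
        rw [show n + 2 - 1 = n + 1 by omega, mul_comm] at h1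
        rw [← h1, one_pow, div_one]
        ring
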